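/- Let $x\in\mathbb{R}^{D_0}$ be a random vector with finite second moments, and let $A=\mathbb{E}[xx^\top]=P_A\Phi P_A^\top$, where $\Phi\in\mathbb{R}^{d_0\times d_0}$ is the diagonal matrix of the $d_0$ positive eigenvalues of $A$ and $P_A\in\mathbb{R}^{D_0\times d_0}$ has orthonormal columns. Put $\tilde x=\Phi^{-1/2}P_A^\top x$ and $Z=\mathbb{E}[x\tilde x^\top]\in\mathbb{R}^{D_0\times d_0}$. Let $\beta_1,\beta_2,\eta_{\mathrm{enc}},\eta_{\mathrm{dec}},\sigma_1>0$, $c=\eta_{\mathrm{dec}}/\eta_{\mathrm{enc}}$, $d_0\ge d_1=d_2$, and let $\Sigma_1=\sigma_1^2 I$ be fixed. Consider the loss of the two-latent linear Markovian hierarchical VAE, $$\begin{aligned}\mathcal{L}(U_1,U_2,V_1,W_2,\Sigma_2)=\frac1{\eta_{\mathrm{dec}}^2}\Big[&\|U_1V_1-Z\|_F^2+\beta_1\|(U_2W_2-I)V_1\|_F^2+\operatorname{tr}(U_1^\top U_1\Sigma_1)+\beta_1\operatorname{tr}(U_2^\top U_2\Sigma_2)\\&+\beta_1\operatorname{tr}\big((U_2W_2-I)^\top(U_2W_2-I)\Sigma_1\big)+\beta_2c^2\|W_2V_1\|_F^2+\beta_2c^2\operatorname{tr}(W_2^\top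 W_2\Sigma_1)+\beta_2c^2\operatorname{tr}(\Sigma_2)\Big]\\&-\beta_1\log|\Sigma_1|-\beta_2\log|\Sigma_2|,\end{aligned}$$ over $U_1\in\mathbb{R}^{D_0\times d_1}$, $U_2\in\mathbb{R}^{d_1\times d_2}$, $V_1\in\mathbb{R}^{d_1\times d_0}$, $W_2\in\mathbb{R}^{d_2\times d_1}$ and positive definite $\Sigma_2\in\mathbb{R}^{d_2\times d_2}$. Then $\mathcal{L}$ has a global minimizer, and $(U_1^*,U_2^*,V_1^*,W_2^*,\Sigma_2^*)$ is a global minimizer if and only if there are a singular value decomposition $Z=R\Theta S^\top$ (with $R\in\mathbb{R}^{D_0\times D_0}$, $S\in\mathbb{R}^{d_0\times d_0}$ orthogonal and singular values $\theta_1\ge\theta_2\ge\dots\ge\theta_{d_0}\ge 0$) and orthogonal matrices $P\in\mathbb{R}^{d_1\times d_1}$, $Q\in\mathbb{R}^{d_2\times d_2}$ such that $$V_1^*=P\Lambda S^\top,\qquad U_2^*=P\Omega Q^\top,\qquad W_2^*=U_2^{*\top}\Big(U_2^*U_2^{*\top}+c^2\tfrac{\beta_2}{\beta_1}I\Big)^{-1},$$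 $$U_1^*=ZV_1^{*\top}\big(V_1^*V_1^{*\top}+\Sigma_1\big)^{-1},\qquad \Sigma_2^*=\tfrac{\beta_2}{\beta_1}\eta_{\mathrm{dec}}^2\Big(U_2^{*\top}U_2^*+c^2\tfrac{\beta_2}{\beta_1}I\Big)^{-1},$$ where $\Lambda\in\mathbb{R}^{d_1\times d_0}$ and $\Omega\in\mathbb{R}^{d_1\times d_2}$ are rectangular diagonal matrices with diagonal entries $\lambda_i^*,\omega_i^*$, $1\le i\le d_1$, given as follows. a) If $\theta_i^2\ge\frac{\beta_2\eta_{\mathrm{dec}}^2}{\sigma_1^2}\max\big(\sigma_1^2,\frac{\beta_2}{\beta_1}\eta_{\mathrm{dec}}^2\big)$: $\ \lambda_i^*=\frac{\sigma_1}{\sqrt{\beta_2}\,\eta_{\mathrm{dec}}}\sqrt{\theta_i^2-\beta_2\eta_{\mathrm{dec}}^2}$, $\ \omega_i^*=\sqrt{\frac{\sigma_1^2\theta_i^2}{\beta_2\eta_{\mathrm{enc}}^2\eta_{\mathrm{dec}}^2}-\frac{\beta_2}{\beta_1}\frac{\eta_{\mathrm{dec}}^2}{\eta_{\mathrm{enc}}^2}}$.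 b) If $\theta_i^2<\frac{\beta_2\eta_{\mathrm{dec}}^2}{\sigma_1^2}\max\big(\sigma_1^2,\frac{\beta_2}{\beta_1}\eta_{\mathrm{dec}}^2\big)$ and $\sigma_1^2\ge\frac{\beta_2}{\beta_1}\eta_{\mathrm{dec}}^2$: $\ \lambda_i^*=0$, $\ \omega_i^*=\sqrt{\big(\sigma_1^2-\frac{\beta_2}{\beta_1}\eta_{\mathrm{dec}}^2\big)/\eta_{\mathrm{enc}}^2}$. c) If $\theta_i^2<\frac{\beta_2\eta_{\mathrm{dec}}^2}{\sigma_1^2}\max\big(\sigma_1^2,\frac{\beta_2}{\beta_1}\eta_{\mathrm{dec}}^2\big)$ and $\sigma_1^2<\frac{\beta_2}{\beta_1}\eta_{\mathrm{dec}}^2$: $\ \lambda_i^*=\sqrt{\max\big(0,\frac{\sigma_1}{\sqrt{\beta_1}}(\theta_i-\sqrt{\beta_1}\,\sigma_1)\big)}$, $\ \omega_i^*=0$. -/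

import Mathlib

open MeasureTheory

namespace HVAE

noncomputable section

/-- Squared Frobenius norm `‖M‖_F²`. -/
def frobSq {m n : ℕ} (M : Matrix (Fin m) (Fin n) ℝ) : ℝ :=
  ∑ i, ∑ j, M i j ^ 2

/-- The `m × n` rectangular diagonal matrix with diagonal entries `a 0, a 1, …`
(diagonal positions are numbered from zero). -/
def rectDiag (m n : ℕ) (a : ℕ → ℝ) : Matrix (Fin m) (Fin n) ℝ :=
  Matrix.of fun i j => if (i : ℕ) = (j : ℕ) then a i else 0

/-- `Z = R Θ Sᵀ` is a (full) singular value decomposition of `Z`, with singular values `θ`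
in nonincreasing order; by convention `θ i = 0` beyond the diagonal. -/
structure IsSVD {m n : ℕ} (Z : Matrix (Fin m) (Fin n) ℝ) (R : Matrix (Fin m) (Fin m) ℝ)
    (θ : ℕ → ℝ) (S : Matrix (Fin n) (Fin n) ℝ) : Prop where
  left_orthogonal : R ∈ Matrix.orthogonalGroup (Fin m) ℝ
  right_orthogonal : S ∈ Matrix.orthogonalGroup (Fin n) ℝ
  antitone : Antitone θ
  nonneg : ∀ i, 0 ≤ θ i
  eq_zero : ∀ i, min m n ≤ i → θ i = 0
  eq : Z = R * rectDiag m n θ * S.transpose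

/-- The second moment matrix `A = E[x xᵀ]` of the data distribution `μ`. -/
def secondMoment {D₀ : ℕ} (μ : Measure (Fin D₀ → ℝ)) : Matrix (Fin D₀) (Fin D₀) ℝ :=
  Matrix.of fun i j => ∫ x, x i * x j ∂μ

/-- `A = P_A Φ P_Aᵀ` with `Φ = diag φ` of size `d₀ × d₀`, all `φ i > 0`, and `P_A` with
orthonormal columns: the eigenvalue decomposition of `A` restricted to its positive eigenvalues,
whose number is `d₀`. -/
structure IsPosEigenDecomp {D₀ d₀ : ℕ} (A : Matrix (Fin D₀) (Fin D₀) ℝ)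
    (PA : Matrix (Fin D₀) (Fin d₀) ℝ) (φ : Fin d₀ → ℝ) : Prop where
  orthonormal : PA.transpose * PA = 1
  pos : ∀ i, 0 < φ i
  eq : A = PA * Matrix.diagonal φ * PA.transpose

/-- The whitening `x̃ = Φ^{-1/2} P_Aᵀ x`. -/
def whiten {D₀ d₀ : ℕ} (PA : Matrix (Fin D₀) (Fin d₀) ℝ) (φ : Fin d₀ → ℝ)
    (x : Fin D₀ → ℝ) : Fin d₀ → ℝ :=
  (Matrix.diagonal fun i => (Real.sqrt (φ i))⁻¹).mulVec (PA.transpose.mulVec x)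

/-- `Z = E[x x̃ᵀ]`. -/
def crossMoment {D₀ d₀ : ℕ} (μ : Measure (Fin D₀ → ℝ))
    (PA : Matrix (Fin D₀) (Fin d₀) ℝ) (φ : Fin d₀ → ℝ) : Matrix (Fin D₀) (Fin d₀) ℝ :=
  Matrix.of fun i j => ∫ x, x i * whiten PA φ x j ∂μ

/-- The training loss of the linear two-latent Markovian hierarchical VAE, in whitened
coordinates (`V1` stands for `W₁ P_A Φ^{1/2}`), with `c = η_dec / η_enc`. -/
def loss {D₀ d₀ d₁ d₂ : ℕ} (β₁ β₂ ηenc ηdec : ℝ) (Z : Matrix (Fin D₀) (Fin d₀) ℝ)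
    (U1 : Matrix (Fin D₀) (Fin d₁) ℝ) (U2 : Matrix (Fin d₁) (Fin d₂) ℝ)
    (V1 : Matrix (Fin d₁) (Fin d₀) ℝ) (W2 : Matrix (Fin d₂) (Fin d₁) ℝ)
    (S1 : Matrix (Fin d₁) (Fin d₁) ℝ) (S2 : Matrix (Fin d₂) (Fin d₂) ℝ) : ℝ :=
  1 / ηdec ^ 2 *
      (frobSq (U1 * V1 - Z)
        + β₁ * frobSq ((U2 * W2 - 1) * V1)
        + Matrix.trace (U1.transpose * U1 * S1)
        + β₁ * Matrix.trace (U2.transpose * U2 * S2)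
        + β₁ * Matrix.trace ((U2 * W2 - 1).transpose * (U2 * W2 - 1) * S1)
        + β₂ * (ηdec / ηenc) ^ 2 * frobSq (W2 * V1)
        + β₂ * (ηdec / ηenc) ^ 2 * Matrix.trace (W2.transpose * W2 * S1)
        + β₂ * (ηdec / ηenc) ^ 2 * Matrix.trace S2)
    - β₁ * Real.log S1.det - β₂ * Real.log S2.det

/-- `(U1, U2, V1, W2, S2)` is a global minimizer of the loss for the fixed first encoder variance
`S1`; the second encoder variance `S2` ranges over all positive definite matrices. -/
def IsGlobalMinimizer {D₀ d₀ d₁ d₂ : ℕ} (β₁ β₂ ηenc ηdec : ℝ)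
    (Z : Matrix (Fin D₀) (Fin d₀) ℝ) (S1 : Matrix (Fin d₁) (Fin d₁) ℝ)
    (U1 : Matrix (Fin D₀) (Fin d₁) ℝ) (U2 : Matrix (Fin d₁) (Fin d₂) ℝ)
    (V1 : Matrix (Fin d₁) (Fin d₀) ℝ) (W2 : Matrix (Fin d₂) (Fin d₁) ℝ)
    (S2 : Matrix (Fin d₂) (Fin d₂) ℝ) : Prop :=
  S2.PosDef ∧
    ∀ (U1' : Matrix (Fin D₀) (Fin d₁) ℝ) (U2' : Matrix (Fin d₁) (Fin d₂) ℝ)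
      (V1' : Matrix (Fin d₁) (Fin d₀) ℝ) (W2' : Matrix (Fin d₂) (Fin d₁) ℝ)
      (S2' : Matrix (Fin d₂) (Fin d₂) ℝ), S2'.PosDef →
      loss β₁ β₂ ηenc ηdec Z U1 U2 V1 W2 S1 S2 ≤
        loss β₁ β₂ ηenc ηdec Z U1' U2' V1' W2' S1 S2'

end

end HVAE

namespace HVAE

open Matrix

/-! ### Orthogonal matrices and the sorted spectral theorem -/

/-! Write $b=\beta_1$, $e=\beta_2\eta_{\rm dec}^2$, $k=c^2\beta_2/\beta_1$, $H=\eta_{\rm enc}^2$,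
$s=\sigma_1^2$, so that $bkH=e$. Up to a positive factor and a constant the loss is `coreLoss`,
which is bounded below by eliminating one variable at a time, always with the equality case.

For fixed $V=V_1$ and $U_2$, both $U_1$ and $W_2$ solve ridge regressions (`decoder_bound`,
`encoder_bound`), and $\Sigma_2$ is determined by $\log\det A\le\operatorname{tr}A-n$
(`variance_bound`). What remains is $s\operatorname{tr}(Z^\top Z(V^\top V+s)^{-1})$ plus $\frac
eH\operatorname{tr}(B^{-1}M)+e\log\det B$ and a constant, where $B=U_2U_2^\top+k$ and $M=VV^\top+s$.
The best $B\succeq k$ has the eigenvectors of $M$ and the eigenvalues $\max(m_i/H,k)$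
(`second_decoder_bound`).

Only the first term changes under $V\mapsto VO$ with $O$ orthogonal. At a rotation minimizing it,
testing against Householder reflections shows that $Z^\top Z$ and $V^\top V+s$ share a sorted
eigenbasis (`exists_joint_sorted_diagonalization`), so $V$ is aligned with an SVD of $Z$. The
problem then splits into scalar ones: minimize $u_i/m+\mathrm{profile}(m/\tau)$ over $m\ge s$, with
$u_i=s\theta_i^2/e$ and $\tau=kH$. The unique minimizer `optVar` (`optVar_lt`) yields cases a), b),
c). The explicit formulas attain the bound, which gives existence, and the equality cases give the
characterization. -/

theorem orthogonal_mul_transpose {n : ℕ} {S : Matrix (Fin n) (Fin n) ℝ}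
    (hS : S ∈ Matrix.orthogonalGroup (Fin n) ℝ) : S * Sᵀ = 1 := by
  exact (Matrix.mem_orthogonalGroup_iff _ _).1 hS

theorem orthogonal_transpose_mul {n : ℕ} {S : Matrix (Fin n) (Fin n) ℝ}
    (hS : S ∈ Matrix.orthogonalGroup (Fin n) ℝ) : Sᵀ * S = 1 := by
  exact (Matrix.mem_orthogonalGroup_iff' _ _).1 hS

theorem mem_orthogonal_of_transpose_mul {n : ℕ} {S : Matrix (Fin n) (Fin n) ℝ}
    (hS : Sᵀ * S = 1) : S ∈ Matrix.orthogonalGroup (Fin n) ℝ := by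
  exact (Matrix.mem_orthogonalGroup_iff' _ _).2 hS

/-- Spectral theorem for real symmetric matrices, with eigenvalues in nonincreasing order. -/
theorem exists_sorted_diagonalization {n : ℕ} {A : Matrix (Fin n) (Fin n) ℝ} (hA : A.IsHermitian) :
    ∃ S ∈ Matrix.orthogonalGroup (Fin n) ℝ, ∃ t : Fin n → ℝ, Antitone t ∧
      A = S * diagonal t * Sᵀ := by
  set U : Matrix (Fin n) (Fin n) ℝ := hA.eigenvectorUnitary.1 with hU
  have hUo : U ∈ Matrix.orthogonalGroup (Fin n) ℝ := hA.eigenvectorUnitary.2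
  have hAU : A = U * diagonal hA.eigenvalues * Uᵀ := by
    have h := hA.spectral_theorem
    rw [Unitary.conjStarAlgAut_apply] at h
    simpa [star_eq_conjTranspose, Function.comp_def] using h
  -- Sorting the negated eigenvalues upwards lists the eigenvalues in nonincreasing order.
  let σ : Equiv.Perm (Fin n) := Tuple.sort (fun i => -hA.eigenvalues i)
  have hσ : Monotone ((fun i => -hA.eigenvalues i) ∘ σ) := Tuple.monotone_sort _
  have hperm : ∀ B : Matrix (Fin n) (Fin n) ℝ,
      B.submatrix id σ * (B.submatrix id σ)ᵀ = B * Bᵀ := fun B => by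
    ext i j
    simp only [mul_apply, submatrix_apply, transpose_apply, id]
    exact Equiv.sum_comp σ (fun k => B i k * B j k)
  refine ⟨U.submatrix id σ, ?_, hA.eigenvalues ∘ σ, ?_, ?_⟩
  · rw [Matrix.mem_orthogonalGroup_iff]
    have := hperm U
    rw [orthogonal_mul_transpose hUo] at this
    exact this
  · intro i j hij
    have := hσ hij
    simpa using this
  · conv_lhs => rw [hAU]
    ext i j
    rw [mul_apply, mul_apply]
    simp only [mul_diagonal, submatrix_apply, transpose_apply, id, Function.comp]
    exact (Equiv.sum_comp σ (fun k => U i k * hA.eigenvalues k * U j k)).symm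

/-- The sorted eigenvalues of a symmetric matrix are unique. -/
theorem diagonalization_unique {n : ℕ} {S S' : Matrix (Fin n) (Fin n) ℝ} {t t' : Fin n → ℝ}
    (hS : S ∈ Matrix.orthogonalGroup (Fin n) ℝ) (hS' : S' ∈ Matrix.orthogonalGroup (Fin n) ℝ)
    (ht : Antitone t) (ht' : Antitone t')
    (h : S * diagonal t * Sᵀ = S' * diagonal t' * S'ᵀ) : t = t' := by
  have key : ∀ {S : Matrix (Fin n) (Fin n) ℝ} {t : Fin n → ℝ},
      S ∈ Matrix.orthogonalGroup (Fin n) ℝ →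
      -- The multiset of entries of `t` is read off the characteristic polynomial; two sorted lists
      -- with equal multisets coincide.
      (S * diagonal t * Sᵀ).charpoly.roots = Multiset.map t Finset.univ.val := by
    intro S t hS
    rw [Matrix.charpoly_mul_comm, ← mul_assoc, orthogonal_transpose_mul hS, one_mul,
      Matrix.charpoly_diagonal]
    have := Polynomial.roots_multiset_prod_X_sub_C (Multiset.map t Finset.univ.val)
    rw [Multiset.map_map] at this
    exact this
  have hm : Multiset.map t Finset.univ.val = Multiset.map t' Finset.univ.val := by
    rw [← key hS, ← key hS', h]
  rw [Fin.univ_val_map, Fin.univ_val_map, Multiset.coe_eq_coe] at hm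
  exact List.ofFn_injective (hm.eq_of_sortedGE ht.sortedGE_ofFn ht'.sortedGE_ofFn)

/-! ### Positive definite matrices -/

theorem posDef_gram_add {m n : ℕ} (X : Matrix (Fin m) (Fin n) ℝ) {s : ℝ} (hs : 0 < s) :
    (X * Xᵀ + s • (1 : Matrix (Fin m) (Fin m) ℝ)).PosDef := by
  have h1 : (X * Xᵀ).PosSemidef := by
    simpa using Matrix.posSemidef_self_mul_conjTranspose X
  exact Matrix.PosDef.posSemidef_add h1 (Matrix.PosDef.one.smul hs)

theorem posDef_gram_add' {m n : ℕ} (X : Matrix (Fin m) (Fin n) ℝ) {s : ℝ} (hs : 0 < s) :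
    (Xᵀ * X + s • (1 : Matrix (Fin n) (Fin n) ℝ)).PosDef := by
  simpa using posDef_gram_add Xᵀ hs

theorem PosDef.isUnit_det' {n : ℕ} {A : Matrix (Fin n) (Fin n) ℝ} (hA : A.PosDef) :
    IsUnit A.det := hA.det_pos.ne'.isUnit

/-- A positive definite matrix is a Gram matrix of an invertible one. -/
theorem exists_gram {n : ℕ} {G : Matrix (Fin n) (Fin n) ℝ} (hG : G.PosDef) :
    ∃ L : Matrix (Fin n) (Fin n) ℝ, IsUnit L.det ∧ G = Lᵀ * L := by
  open scoped MatrixOrder in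
  obtain ⟨L, hL⟩ := CStarAlgebra.nonneg_iff_eq_star_mul_self.1 hG.posSemidef.nonneg
  have hL' : G = Lᵀ * L := by simpa [star_eq_conjTranspose] using hL
  refine ⟨L, ?_, hL'⟩
  have := hG.det_pos
  rw [hL', det_mul, det_transpose] at this
  exact isUnit_iff_ne_zero.2 fun h => by simp [h] at this

theorem frobSq_eq_trace {m n : ℕ} (X : Matrix (Fin m) (Fin n) ℝ) :
    frobSq X = trace (Xᵀ * X) := by
  simp only [frobSq, trace, diag_apply, mul_apply, transpose_apply]
  rw [Finset.sum_comm]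
  simp [sq]

theorem frobSq_nonneg {m n : ℕ} (X : Matrix (Fin m) (Fin n) ℝ) : 0 ≤ frobSq X :=
  Finset.sum_nonneg fun _ _ => Finset.sum_nonneg fun _ _ => sq_nonneg _

theorem frobSq_eq_zero {m n : ℕ} {X : Matrix (Fin m) (Fin n) ℝ} (h : frobSq X = 0) : X = 0 := by
  ext i j
  have h1 := (Finset.sum_eq_zero_iff_of_nonneg fun i _ =>
    Finset.sum_nonneg fun j _ => sq_nonneg (X i j)).1 h i (Finset.mem_univ i)
  have h2 := (Finset.sum_eq_zero_iff_of_nonneg fun j _ => sq_nonneg (X i j)).1 h1 j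
    (Finset.mem_univ j)
  simpa using h2

/-- With $G=L^\top L$ and $M=K^\top K$ the trace is $\|LXK^\top\|_F^2$, and $L$, $K$ are invertible.
-/
theorem trace_quadratic_nonneg {m n : ℕ} {G : Matrix (Fin m) (Fin m) ℝ}
    {M : Matrix (Fin n) (Fin n) ℝ} (hG : G.PosDef) (hM : M.PosDef)
    (X : Matrix (Fin m) (Fin n) ℝ) :
    0 ≤ trace (Xᵀ * G * X * M) ∧ (trace (Xᵀ * G * X * M) = 0 → X = 0) := by
  obtain ⟨L, hL, rfl⟩ := exists_gram hG
  obtain ⟨K, hK, rfl⟩ := exists_gram hM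
  have e : trace (Xᵀ * (Lᵀ * L) * X * (Kᵀ * K)) = frobSq (L * X * Kᵀ) := by
    rw [frobSq_eq_trace, ← Matrix.mul_assoc, trace_mul_comm]
    simp only [transpose_mul, transpose_transpose, Matrix.mul_assoc]
  rw [e]
  refine ⟨frobSq_nonneg _, fun h => ?_⟩
  have h0 := frobSq_eq_zero h
  have hKt : IsUnit (Kᵀ).det := by rwa [det_transpose]
  have : L⁻¹ * (L * X * Kᵀ) * (Kᵀ)⁻¹ = X := by
    rw [Matrix.mul_assoc L, nonsing_inv_mul_cancel_left _ _ hL, mul_nonsing_inv_cancel_right _ _ hKt]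
  rw [← this, h0]; simp

/-- The log-determinant inequality, with its equality case. -/
theorem log_det_add_log_det_le {n : ℕ} {G S : Matrix (Fin n) (Fin n) ℝ} (hG : G.PosDef)
    (hS : S.PosDef) :
    Real.log G.det + Real.log S.det ≤ trace (G * S) - n ∧
      (Real.log G.det + Real.log S.det = trace (G * S) - n → G * S = 1) := by
  obtain ⟨L, hL, hGL⟩ := exists_gram hG
  have hA : (L * S * Lᵀ).PosDef := by
    have hi : Function.Injective L.vecMul :=
      Matrix.vecMul_injective_iff_isUnit.2 ((Matrix.isUnit_iff_isUnit_det L).2 hL)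
    simpa using hS.mul_mul_conjTranspose_same hi
  have htr : trace (G * S) = trace (L * S * Lᵀ) := by
    rw [hGL, mul_assoc, trace_mul_comm]
  have hdet : Real.log G.det + Real.log S.det = Real.log (L * S * Lᵀ).det := by
    rw [← Real.log_mul hG.det_pos.ne' hS.det_pos.ne', hGL]
    simp only [det_mul, det_transpose]; ring_nf
  rw [htr, hdet]
  obtain ⟨Q, hQ, t, -, hAt⟩ := exists_sorted_diagonalization hA.isHermitian
  have hdiag : diagonal t = Qᵀ * (L * S * Lᵀ) * Q := by
    rw [hAt]
    simp only [mul_assoc, orthogonal_transpose_mul hQ, mul_one]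
    rw [← mul_assoc, orthogonal_transpose_mul hQ, one_mul]
  have hpos : ∀ i, 0 < t i := by
    have hi : Function.Injective Q.mulVec :=
      Matrix.mulVec_injective_iff_isUnit.2 ((Matrix.isUnit_iff_isUnit_det Q).2
        (isUnit_det_of_left_inverse (orthogonal_transpose_mul hQ)))
    have := hA.conjTranspose_mul_mul_same hi
    rw [conjTranspose_eq_transpose_of_trivial, ← hdiag] at this
    exact Matrix.posDef_diagonal_iff.1 this
  have htrace : trace (L * S * Lᵀ) = ∑ i, t i := by
    rw [hAt, trace_mul_comm, ← mul_assoc, orthogonal_transpose_mul hQ, one_mul, trace_diagonal]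
  have hdet' : Real.log (L * S * Lᵀ).det = ∑ i, Real.log (t i) := by
    rw [hAt, det_mul_comm, ← mul_assoc, orthogonal_transpose_mul hQ, one_mul, det_diagonal,
      Real.log_prod (fun i _ => (hpos i).ne')]
  have hsum : ∑ i, t i - (n : ℝ) = ∑ i, (t i - 1) := by simp
  rw [htrace, hdet', hsum]
  -- The `t i` are the eigenvalues of $LSL^\top$, so the claim is a sum of scalar inequalities $\log
  -- t\le t-1$; equality forces every `t i` to be 1.
  have hle : ∀ i ∈ Finset.univ, Real.log (t i) ≤ t i - 1 := fun i _ =>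
    Real.log_le_sub_one_of_pos (hpos i)
  refine ⟨Finset.sum_le_sum hle, fun h => ?_⟩
  have h1 := (Finset.sum_eq_sum_iff_of_le hle).1 h
  have ht1 : t = fun _ => 1 := by
    funext i
    by_contra hne
    exact (Real.log_lt_sub_one_of_pos (hpos i) hne).ne (h1 i (Finset.mem_univ i))
  have h2 : L * (S * Lᵀ) = 1 := by
    rw [← mul_assoc, hAt, ht1]; simp [orthogonal_mul_transpose hQ]
  have h3 : S * (Lᵀ * L) = 1 := by
    rw [← mul_assoc]; exact mul_eq_one_comm.1 h2
  rw [hGL]; exact mul_eq_one_comm.1 h3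

/-! ### Rotations -/

theorem isCompact_orthogonalGroup (n : ℕ) :
    IsCompact {O : Matrix (Fin n) (Fin n) ℝ | O ∈ Matrix.orthogonalGroup (Fin n) ℝ} := by
  have hsub : {O : Matrix (Fin n) (Fin n) ℝ | O ∈ Matrix.orthogonalGroup (Fin n) ℝ} ⊆
      Set.pi Set.univ fun _ => Set.pi Set.univ fun _ => Set.Icc (-1) 1 := by
    intro O hO i _ j _
    have := entry_norm_bound_of_unitary hO i j
    rw [Real.norm_eq_abs, abs_le] at this
    exact this
  refine IsCompact.of_isClosed_subset
    (isCompact_univ_pi fun _ => isCompact_univ_pi fun _ => isCompact_Icc) ?_ hsub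
  have : {O : Matrix (Fin n) (Fin n) ℝ | O ∈ Matrix.orthogonalGroup (Fin n) ℝ} =
      {O | O * Oᵀ = 1} := by
    ext O
    simp [Matrix.mem_orthogonalGroup_iff]
  rw [this]
  exact isClosed_eq (by fun_prop) continuous_const

/-- Compactness enters only here, through the orthogonal group; existence of a global minimizer of
the loss comes from explicit formulas instead. -/
theorem exists_rotation_minimizer {n : ℕ} (T Y : Matrix (Fin n) (Fin n) ℝ) :
    ∃ O ∈ Matrix.orthogonalGroup (Fin n) ℝ, ∀ O' ∈ Matrix.orthogonalGroup (Fin n) ℝ,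
      trace (T * (Oᵀ * Y * O)) ≤ trace (T * (O'ᵀ * Y * O')) := by
  obtain ⟨O, hO, hmin⟩ := (isCompact_orthogonalGroup n).exists_isMinOn
    ⟨1, (Matrix.orthogonalGroup (Fin n) ℝ).one_mem⟩
    (f := fun O : Matrix (Fin n) (Fin n) ℝ => trace (T * (Oᵀ * Y * O)))
    (by fun_prop)
  exact ⟨O, hO, fun O' hO' => hmin hO'⟩

/-! ### The structure of rotation-optimal pairs -/

/-- If no Householder reflection decreases `tr (T Y)`, then every vector satisfies a reverse
Cauchy–Schwarz inequality with respect to `T` and `Y`. -/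
theorem householder_inequality {n : ℕ} {T Y : Matrix (Fin n) (Fin n) ℝ} (hT : Tᵀ = T) (hY : Yᵀ = Y)
    (hrot : ∀ O ∈ Matrix.orthogonalGroup (Fin n) ℝ, trace (T * Y) ≤ trace (T * (Oᵀ * Y * O)))
    (v : Fin n → ℝ) (hv : v ⬝ᵥ v ≠ 0) :
    (v ⬝ᵥ v) * ((T *ᵥ v) ⬝ᵥ (Y *ᵥ v)) ≤ (v ⬝ᵥ (Y *ᵥ v)) * (v ⬝ᵥ (T *ᵥ v)) := by
  set r := v ⬝ᵥ v with hr
  have hr0 : 0 < r := lt_of_le_of_ne (by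
    rw [hr]; exact Finset.sum_nonneg fun i _ => mul_self_nonneg (v i)) (Ne.symm hv)
  -- With $a=2/|v|^2$ the matrix $H=1-a\,vv^\top$ is the reflection in the hyperplane orthogonal to
  -- $v$; expanding $\operatorname{tr}(THYH)$ gives the inequality.
  set a := 2 / r with ha
  have har : a * r = 2 := by rw [ha]; field_simp
  have ha0 : 0 < a := by positivity
  set H : Matrix (Fin n) (Fin n) ℝ := 1 - a • vecMulVec v v with hH
  have hHt : Hᵀ = H := by
    rw [hH, transpose_sub, transpose_one, transpose_smul, transpose_vecMulVec]
  have hHo : H ∈ Matrix.orthogonalGroup (Fin n) ℝ := by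
    apply mem_orthogonal_of_transpose_mul
    rw [hHt, hH]
    simp only [sub_mul, mul_sub, one_mul, mul_one, Matrix.smul_mul, Matrix.mul_smul, vecMulVec_mul_vecMulVec,
      smul_smul, ← hr]
    rw [vecMulVec_smul, smul_smul, mul_assoc, har]
    module
  have h := hrot H hHo
  rw [hHt] at h
  have hYv : v ᵥ* Y = Y *ᵥ v := by rw [← mulVec_transpose, hY]
  have htr : trace (T * (H * Y * H)) = trace (T * Y) - 2 * a * ((T *ᵥ v) ⬝ᵥ (Y *ᵥ v))
      + a ^ 2 * ((v ⬝ᵥ (Y *ᵥ v)) * (v ⬝ᵥ (T *ᵥ v))) := by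
    have e1 : (T *ᵥ (Y *ᵥ v)) ⬝ᵥ v = (T *ᵥ v) ⬝ᵥ (Y *ᵥ v) := by
      rw [dotProduct_comm, dotProduct_mulVec, ← mulVec_transpose, hT]
    have e2 : (T *ᵥ v) ⬝ᵥ v = v ⬝ᵥ (T *ᵥ v) := dotProduct_comm _ _
    have e3 : (Y *ᵥ v) ⬝ᵥ v = v ⬝ᵥ (Y *ᵥ v) := dotProduct_comm _ _
    rw [hH]
    simp only [sub_mul, mul_sub, one_mul, mul_one, Matrix.smul_mul, Matrix.mul_smul, vecMulVec_mul,
      mul_vecMulVec, trace_sub, trace_smul, trace_vecMulVec, hYv, smul_mulVec, mulVec_smul,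
      vecMulVec_mulVec, op_smul_eq_smul, smul_dotProduct, smul_eq_mul, e1, e2, e3]
    ring
  rw [htr] at h
  have h2 : 2 * ((T *ᵥ v) ⬝ᵥ (Y *ᵥ v)) ≤ a * ((v ⬝ᵥ (Y *ᵥ v)) * (v ⬝ᵥ (T *ᵥ v))) := by
    refine le_of_mul_le_mul_left ?_ ha0
    linarith [h]
  have h3 := mul_le_mul_of_nonneg_left h2 hr0.le
  have : r * (a * ((v ⬝ᵥ (Y *ᵥ v)) * (v ⬝ᵥ (T *ᵥ v)))) =
    2 * ((v ⬝ᵥ (Y *ᵥ v)) * (v ⬝ᵥ (T *ᵥ v))) := by rw [← mul_assoc, mul_comm r a, har]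
  linarith

theorem orthogonal_col_dotProduct {n : ℕ} {S : Matrix (Fin n) (Fin n) ℝ}
    (hS : S ∈ Matrix.orthogonalGroup (Fin n) ℝ) (i j : Fin n) :
    (fun k => S k i) ⬝ᵥ (fun k => S k j) = if i = j then 1 else 0 := by
  have := congrFun (congrFun (orthogonal_transpose_mul hS) i) j
  rw [mul_apply, one_apply] at this
  exact this

theorem eq_diagonalization_of_mulVec {n : ℕ} {A S : Matrix (Fin n) (Fin n) ℝ} {t : Fin n → ℝ}
    (hS : S ∈ Matrix.orthogonalGroup (Fin n) ℝ)
    (h : ∀ j, A *ᵥ (fun k => S k j) = t j • fun k => S k j) : A = S * diagonal t * Sᵀ := by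
  have : A * S = S * diagonal t := by
    ext i j
    rw [mul_diagonal, mul_comm]
    exact congrFun (h j) i
  rw [← this, mul_assoc, orthogonal_mul_transpose hS, mul_one]

theorem diagonalization_mulVec {n : ℕ} {A S : Matrix (Fin n) (Fin n) ℝ} {t : Fin n → ℝ}
    (hS : S ∈ Matrix.orthogonalGroup (Fin n) ℝ) (h : A = S * diagonal t * Sᵀ) (j : Fin n) :
    A *ᵥ (fun k => S k j) = t j • fun k => S k j := by
  have : A * S = S * diagonal t := by
    rw [h, mul_assoc, orthogonal_transpose_mul hS, mul_one]
  ext i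
  have := congrFun (congrFun this i) j
  rw [mul_diagonal, mul_comm] at this
  exact this

/-- If `tr (T N⁻¹)` cannot be decreased by rotating the positive definite matrix `N`, then `T` and
`N` are diagonalized by one orthogonal matrix, with both spectra in nonincreasing order. -/
theorem exists_joint_sorted_diagonalization {n : ℕ} {T N : Matrix (Fin n) (Fin n) ℝ}
    (hT : Tᵀ = T) (hN : N.PosDef)
    (hrot : ∀ O ∈ Matrix.orthogonalGroup (Fin n) ℝ,
      trace (T * N⁻¹) ≤ trace (T * (Oᵀ * N⁻¹ * O))) :
    ∃ S ∈ Matrix.orthogonalGroup (Fin n) ℝ, ∃ t ν : Fin n → ℝ, Antitone t ∧ Antitone ν ∧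
      T = S * diagonal t * Sᵀ ∧ N = S * diagonal ν * Sᵀ := by
  have hNt : Nᵀ = N := by simpa using hN.isHermitian.eq
  have hYt : (N⁻¹)ᵀ = N⁻¹ := by rw [transpose_nonsing_inv, hNt]
  have hYN : N⁻¹ * N = 1 := nonsing_inv_mul _ (PosDef.isUnit_det' hN)
  have hC : (T + N).IsHermitian := by
    simp [Matrix.IsHermitian, hT, hNt]
  -- Diagonalizing the sum $T+N$ serves both purposes: its eigenvectors will turn out to be
  -- eigenvectors of $T$ and $N$ separately, and its sorted spectrum will force both spectra to be
  -- sorted.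
  obtain ⟨S, hS, c, hc, hSc⟩ := exists_sorted_diagonalization hC
  have hpos : ∀ v : Fin n → ℝ, v ≠ 0 → 0 < v ⬝ᵥ (N⁻¹ *ᵥ v) := fun v hv => by
    simpa using hN.inv.dotProduct_mulVec_pos hv
  have hNv : ∀ j, N *ᵥ (fun k => S k j) =
      ((fun k => S k j) ⬝ᵥ (N *ᵥ (fun k => S k j))) • (fun k => S k j) := by
    intro j
    set v : Fin n → ℝ := fun k => S k j with hv
    have hvv : v ⬝ᵥ v = 1 := by simpa using orthogonal_col_dotProduct hS j j
    have hCv := diagonalization_mulVec hS hSc j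
    rw [← hv, add_mulVec] at hCv
    have hTv : T *ᵥ v = c j • v - N *ᵥ v := eq_sub_of_add_eq hCv
    have hYNv : N⁻¹ *ᵥ (N *ᵥ v) = v := by rw [mulVec_mulVec, hYN, one_mulVec]
    have hNvYv : (N *ᵥ v) ⬝ᵥ (N⁻¹ *ᵥ v) = 1 := by
      rw [dotProduct_mulVec, ← mulVec_transpose, hYt, hYNv, hvv]
    -- Since $Tv=cv-Nv$, this reads $my\le1$ for $m=v\cdot Nv$, $y=v\cdot N^{-1}v$. Cauchy–Schwarz
    -- gives $my\ge1$, with equality only if $Nv=mv$; below it appears as positivity of the form of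
    -- $N^{-1}$ at $Nv-mv$.
    have hin := householder_inequality hT hYt hrot v (by rw [hvv]; exact one_ne_zero)
    rw [hTv, hvv, sub_dotProduct, hNvYv, dotProduct_sub, smul_dotProduct, dotProduct_smul, hvv]
      at hin
    set m := v ⬝ᵥ (N *ᵥ v) with hm
    set y := v ⬝ᵥ (N⁻¹ *ᵥ v) with hy
    simp only [smul_eq_mul] at hin
    have hm0 : 0 ≤ m := by simpa using hN.posSemidef.dotProduct_mulVec_nonneg v
    by_contra hne
    have hp := hpos (N *ᵥ v - m • v) (sub_ne_zero.2 hne)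
    have : (N *ᵥ v - m • v) ⬝ᵥ (N⁻¹ *ᵥ (N *ᵥ v - m • v)) = m * (m * y - 1) := by
      rw [mulVec_sub, hYNv, mulVec_smul, dotProduct_sub, sub_dotProduct, sub_dotProduct,
        dotProduct_smul, dotProduct_smul, hNvYv, smul_dotProduct, smul_dotProduct, hvv,
        dotProduct_comm (N *ᵥ v) v, ← hm, ← hy]
      simp only [smul_eq_mul]; ring
    rw [this] at hp
    nlinarith
  set ν : Fin n → ℝ := fun j => (fun k => S k j) ⬝ᵥ (N *ᵥ (fun k => S k j)) with hν
  set t : Fin n → ℝ := fun j => c j - ν j with ht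
  have hTv : ∀ j, T *ᵥ (fun k => S k j) = t j • (fun k => S k j) := by
    intro j
    have hCv := diagonalization_mulVec hS hSc j
    rw [add_mulVec, hNv j] at hCv
    rw [ht, sub_smul]
    exact eq_sub_of_add_eq hCv
  have hνpos : ∀ j, 0 < ν j := by
    intro j
    have hv0 : (fun k => S k j) ≠ 0 := by
      intro h
      have := orthogonal_col_dotProduct hS j j
      rw [h] at this
      simp at this
    simpa using hN.dotProduct_mulVec_pos hv0
  have hYv : ∀ j, N⁻¹ *ᵥ (fun k => S k j) = (ν j)⁻¹ • (fun k => S k j) := by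
    intro j
    have h1 := congrArg (fun w => (ν j)⁻¹ • (N⁻¹ *ᵥ w)) (hNv j)
    simp only [mulVec_mulVec, hYN, one_mulVec, mulVec_smul, smul_smul] at h1
    rw [inv_mul_cancel₀ (hνpos j).ne', one_smul] at h1
    exact h1.symm
  have hopp : ∀ i j, 0 ≤ (t i - t j) * (ν i - ν j) := by
    intro i j
    rcases eq_or_ne i j with rfl | hij
    · simp
    have d11 := orthogonal_col_dotProduct hS i i
    have d12 := orthogonal_col_dotProduct hS i j
    have d21 := orthogonal_col_dotProduct hS j i
    have d22 := orthogonal_col_dotProduct hS j j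
    simp only [if_true, hij, hij.symm, if_false] at d11 d12 d21 d22
    -- The reflection along the sum of two basis vectors exchanges them up to sign, so this compares
    -- the two pairings of the eigenvalues.
    have hin := householder_inequality hT hYt hrot ((fun k => S k i) + fun k => S k j) (by
      simp only [add_dotProduct, dotProduct_add, d11, d12, d21, d22]; norm_num)
    simp only [mulVec_add, hTv, hYv, add_dotProduct, dotProduct_add, smul_dotProduct,
      dotProduct_smul, d11, d12, d21, d22, smul_eq_mul] at hin
    have hi := hνpos i
    have hj := hνpos j
    have h1 : 0 ≤ -(t i - t j) * ((ν i)⁻¹ - (ν j)⁻¹) := by linarith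
    have h2 : -(t i - t j) * ((ν i)⁻¹ - (ν j)⁻¹) = (t i - t j) * (ν i - ν j) / (ν i * ν j) := by
      field_simp; ring
    rw [h2] at h1
    have := mul_nonneg h1 (mul_pos hi hj).le
    rwa [div_mul_cancel₀ _ (mul_pos hi hj).ne'] at this
  have hcsum : ∀ i, c i = t i + ν i := fun i => by simp [ht]
  refine ⟨S, hS, t, ν, ?_, ?_, eq_diagonalization_of_mulVec hS hTv,
    eq_diagonalization_of_mulVec hS hNv⟩
  · intro i j hij
    have h1 := hc hij
    rw [hcsum, hcsum] at h1
    by_contra hlt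
    have := hopp i j
    nlinarith
  · intro i j hij
    have h1 := hc hij
    rw [hcsum, hcsum] at h1
    by_contra hlt
    have := hopp i j
    nlinarith

/-! ### Singular value decompositions from spectral decompositions -/

/-- The columns of $VS$ are orthogonal with squared norms `x i`. The nonzero ones, normalized and
completed to an orthonormal basis, are the columns of $P$. Since `x` is nonincreasing they come
first, and there is room for at most `m` of them. Applied to $Z$, $V$ and $U_2^\top$. -/
theorem exists_left_factor {m n : ℕ} {V : Matrix (Fin m) (Fin n) ℝ} {S : Matrix (Fin n) (Fin n) ℝ}
    {x : ℕ → ℝ} (hS : S ∈ Matrix.orthogonalGroup (Fin n) ℝ) (hx : Antitone x)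
    (h : Vᵀ * V = S * diagonal (fun i : Fin n => x i) * Sᵀ) :
    (∃ P ∈ Matrix.orthogonalGroup (Fin m) ℝ,
      V = P * rectDiag m n (fun i => Real.sqrt (x i)) * Sᵀ) ∧
    ∀ i, m ≤ i → i < n → x i = 0 := by
  set W := V * S with hW
  have hWW : Wᵀ * W = diagonal (fun i : Fin n => x i) := by
    rw [hW, transpose_mul, Matrix.mul_assoc, ← Matrix.mul_assoc Vᵀ, h]
    simp only [mul_assoc, orthogonal_transpose_mul hS, mul_one]
    rw [← mul_assoc, orthogonal_transpose_mul hS, one_mul]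
  have hdot : ∀ i j, ∑ k, W k i * W k j = if i = j then x i else 0 := by
    intro i j
    have := congrFun (congrFun hWW i) j
    rw [mul_apply, diagonal_apply] at this
    exact this
  let w : Fin n → EuclideanSpace ℝ (Fin m) := fun j => WithLp.toLp 2 fun k => W k j
  have hinner : ∀ i j, inner ℝ (w i) (w j) = if i = j then x i else 0 := by
    intro i j
    rw [← hdot, PiLp.inner_apply]
    exact Finset.sum_congr rfl fun k _ => by simp [w, mul_comm]
  have hx0 : ∀ i : Fin n, 0 ≤ x i := by
    intro i
    have := hinner i i
    rw [if_pos rfl] at this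
    rw [← this]; exact real_inner_self_nonneg
  let v : Fin m → EuclideanSpace ℝ (Fin m) := fun i =>
    if h : (i : ℕ) < n then (Real.sqrt (x i))⁻¹ • w ⟨i, h⟩ else 0
  let s : Set (Fin m) := {i | (i : ℕ) < n ∧ 0 < x i}
  have hv : Orthonormal ℝ (s.domRestrict v) := by
    rw [orthonormal_iff_ite]
    rintro ⟨i, hi, hxi⟩ ⟨j, hj, hxj⟩
    have e1 : s.domRestrict v ⟨i, hi, hxi⟩ = (Real.sqrt (x i))⁻¹ • w ⟨i, hi⟩ := by
      simp [v, hi]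
    have e2 : s.domRestrict v ⟨j, hj, hxj⟩ = (Real.sqrt (x j))⁻¹ • w ⟨j, hj⟩ := by
      simp [v, hj]
    rw [e1, e2, inner_smul_left, inner_smul_right, hinner]
    by_cases hij : i = j
    · subst hij
      simp only [if_true]
      have hs := Real.mul_self_sqrt hxi.le
      have hs0 : Real.sqrt (x i) ≠ 0 := (Real.sqrt_pos.2 hxi).ne'
      simp only [conj_trivial]
      field_simp
      rw [sq]; exact hs.symm
    · have : ¬ (i : ℕ) = j := fun h => hij (Fin.ext h)
      simp [hij, this]
  obtain ⟨b, hb⟩ := hv.exists_orthonormalBasis_extension_of_card_eq (by simp)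
  have hbv : ∀ (i : Fin m) (hi : (i : ℕ) < n), 0 < x i → w ⟨i, hi⟩ = Real.sqrt (x i) • b i := by
    intro i hi hxi
    rw [hb i ⟨hi, hxi⟩]
    simp only [v, hi, dif_pos, smul_smul]
    rw [mul_inv_cancel₀ (Real.sqrt_pos.2 hxi).ne', one_smul]
  have hzero : ∀ i, m ≤ i → i < n → x i = 0 := by
    intro i hmi hin
    by_contra hne
    have hpos : 0 < x i := lt_of_le_of_ne (hx0 ⟨i, hin⟩) (Ne.symm hne)
    -- If `x i` were positive with `i ≥ m`, each of the `m` basis vectors would be a multiple of an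
    -- earlier column, hence orthogonal to column `i`.
    have horth : ∀ j, inner ℝ (b j) (w ⟨i, hin⟩) = 0 := by
      intro j
      have hji : (j : ℕ) < i := j.2.trans_le hmi
      have hjn : (j : ℕ) < n := hji.trans hin
      have hxj : 0 < x j := hpos.trans_le (hx hji.le)
      have h1 := hinner ⟨j, hjn⟩ ⟨i, hin⟩
      rw [hbv j hjn hxj, inner_smul_left, if_neg (by simp [Fin.ext_iff, hji.ne])] at h1
      exact (mul_eq_zero.1 h1).resolve_left (by simpa using (Real.sqrt_pos.2 hxj).ne')
    have h0 : w ⟨i, hin⟩ = 0 := by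
      rw [← b.sum_repr' (w ⟨i, hin⟩)]
      exact Finset.sum_eq_zero fun j _ => by rw [horth, zero_smul]
    have := hinner ⟨i, hin⟩ ⟨i, hin⟩
    rw [h0, if_pos rfl] at this
    simp at this
    exact hne this.symm
  refine ⟨⟨Matrix.of fun k i => b i k, ?_, ?_⟩, hzero⟩
  · apply mem_orthogonal_of_transpose_mul
    ext i j
    rw [mul_apply, one_apply, ← orthonormal_iff_ite.1 b.orthonormal i j, PiLp.inner_apply]
    exact Finset.sum_congr rfl fun k _ => by simp [mul_comm]
  · have hWP : W = (Matrix.of fun k i => b i k) * rectDiag m n (fun i => Real.sqrt (x i)) := by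
      ext k j
      have hwk : W k j = w j k := rfl
      have hw0 : x j = 0 → w j = 0 := fun h0 => by
        have := hinner j j
        rw [if_pos rfl, h0] at this
        exact inner_self_eq_zero.1 this
      rw [hwk, mul_apply]
      simp only [rectDiag, of_apply]
      rcases lt_or_ge (j : ℕ) m with hj | hj
      · rw [Finset.sum_eq_single ⟨j, hj⟩]
        · rcases (hx0 j).eq_or_lt with h0 | h0
          · rw [hw0 h0.symm, ← h0]; simp
          · have := hbv ⟨j, hj⟩ j.2 h0
            rw [this]; simp [mul_comm]
        · intro i _ hi
          rw [if_neg fun h => hi (Fin.ext h), mul_zero]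
        · simp
      · rw [hw0 (hzero j hj j.2)]
        refine (Finset.sum_eq_zero fun i _ => ?_).symm
        rw [if_neg (by have := i.2; omega), mul_zero]
    rw [← hWP, hW, Matrix.mul_assoc, orthogonal_mul_transpose hS, Matrix.mul_one]

/-! ### Elimination of the linear parameters and of the latent variance -/

/-- The push-through identity, which trades the Gram matrix on one side of $X$ for the one on the
other. -/
theorem mul_gram_inv {m n : ℕ} (X : Matrix (Fin m) (Fin n) ℝ) {s : ℝ} (hs : 0 < s) :
    X * (Xᵀ * X + s • (1 : Matrix (Fin n) (Fin n) ℝ))⁻¹ =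
      (X * Xᵀ + s • (1 : Matrix (Fin m) (Fin m) ℝ))⁻¹ * X := by
  have h1 := PosDef.isUnit_det' (posDef_gram_add X hs)
  have h2 := PosDef.isUnit_det' (posDef_gram_add' X hs)
  have h : (X * Xᵀ + s • (1 : Matrix (Fin m) (Fin m) ℝ)) * X =
      X * (Xᵀ * X + s • (1 : Matrix (Fin n) (Fin n) ℝ)) := by
    rw [Matrix.add_mul, Matrix.mul_add, Matrix.mul_assoc]; simp
  calc _ = (X * Xᵀ + s • (1 : Matrix (Fin m) (Fin m) ℝ))⁻¹ *
        ((X * Xᵀ + s • (1 : Matrix (Fin m) (Fin m) ℝ)) * X) *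
        (Xᵀ * X + s • (1 : Matrix (Fin n) (Fin n) ℝ))⁻¹ := by
        rw [nonsing_inv_mul_cancel_left _ _ h1]
    _ = _ := by rw [h, ← Matrix.mul_assoc, mul_nonsing_inv_cancel_right _ _ h2]

theorem mul_gram_inv_mul {m n : ℕ} (X : Matrix (Fin m) (Fin n) ℝ) {s : ℝ} (hs : 0 < s) :
    X * (Xᵀ * X + s • (1 : Matrix (Fin n) (Fin n) ℝ))⁻¹ * Xᵀ =
      1 - s • (X * Xᵀ + s • (1 : Matrix (Fin m) (Fin m) ℝ))⁻¹ := by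
  have h1 := PosDef.isUnit_det' (posDef_gram_add X hs)
  rw [mul_gram_inv X hs, Matrix.mul_assoc, eq_sub_iff_add_eq]
  have h2 := nonsing_inv_mul _ h1
  rw [Matrix.mul_add] at h2
  simpa using h2

/-- The weight $M$ multiplies the whole quadratic expression, so the minimizing $X=G^{-1}Y$ does not
depend on it. This is why the optimal second encoder depends on $U_2$ alone. -/
theorem complete_square {n p : ℕ} {G : Matrix (Fin n) (Fin n) ℝ} {M : Matrix (Fin p) (Fin p) ℝ}
    (hG : G.PosDef) (hM : M.PosDef) (X Y : Matrix (Fin n) (Fin p) ℝ) :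
    trace (Xᵀ * G * X * M) - 2 * trace (Xᵀ * Y * M) =
      trace ((X - G⁻¹ * Y)ᵀ * G * (X - G⁻¹ * Y) * M) - trace (Yᵀ * G⁻¹ * Y * M) := by
  have hGt : Gᵀ = G := by simpa using hG.isHermitian.eq
  have hMt : Mᵀ = M := by simpa using hM.isHermitian.eq
  have hd := PosDef.isUnit_det' hG
  have e1 : (G⁻¹ * Y)ᵀ * G = Yᵀ := by
    rw [transpose_mul, transpose_nonsing_inv, hGt, nonsing_inv_mul_cancel_right _ _ hd]
  have e2 : G * (G⁻¹ * Y) = Y := mul_nonsing_inv_cancel_left _ _ hd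
  have e3 : trace (Yᵀ * X * M) = trace (Xᵀ * Y * M) := by
    rw [← trace_transpose, transpose_mul, transpose_mul, transpose_transpose, hMt, trace_mul_comm]
  have e4 : (X - G⁻¹ * Y)ᵀ * G * (X - G⁻¹ * Y) =
      Xᵀ * G * X - Xᵀ * Y - Yᵀ * X + Yᵀ * G⁻¹ * Y := by
    rw [transpose_sub, Matrix.sub_mul, e1, Matrix.sub_mul, Matrix.mul_sub, Matrix.mul_sub,
      Matrix.mul_assoc Xᵀ G (G⁻¹ * Y), e2, Matrix.mul_assoc Yᵀ]
    abel
  rw [e4, Matrix.add_mul, Matrix.sub_mul, Matrix.sub_mul, trace_add, trace_sub, trace_sub, e3]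
  ring

theorem complete_square_bound {n p : ℕ} {G : Matrix (Fin n) (Fin n) ℝ}
    {M : Matrix (Fin p) (Fin p) ℝ} (hG : G.PosDef) (hM : M.PosDef)
    (X Y : Matrix (Fin n) (Fin p) ℝ) :
    -trace (Yᵀ * G⁻¹ * Y * M) ≤ trace (Xᵀ * G * X * M) - 2 * trace (Xᵀ * Y * M) ∧
      (trace (Xᵀ * G * X * M) - 2 * trace (Xᵀ * Y * M) = -trace (Yᵀ * G⁻¹ * Y * M) ↔
        X = G⁻¹ * Y) := by
  have h := trace_quadratic_nonneg hG hM (X - G⁻¹ * Y)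
  rw [complete_square hG hM]
  refine ⟨by linarith [h.1], fun e => sub_eq_zero.1 (h.2 (by linarith)), fun e => ?_⟩
  rw [sub_eq_zero.2 e]; simp

/-- Elimination of the first decoder. -/
theorem decoder_bound {D n p : ℕ} {s : ℝ} (hs : 0 < s) (Z : Matrix (Fin D) (Fin p) ℝ)
    (U : Matrix (Fin D) (Fin n) ℝ) (V : Matrix (Fin n) (Fin p) ℝ) :
    s * trace (Zᵀ * Z * (Vᵀ * V + s • 1)⁻¹) ≤ frobSq (U * V - Z) + s * trace (Uᵀ * U) ∧
      (frobSq (U * V - Z) + s * trace (Uᵀ * U) = s * trace (Zᵀ * Z * (Vᵀ * V + s • 1)⁻¹) ↔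
        U = Z * Vᵀ * (V * Vᵀ + s • 1)⁻¹) := by
  have hM := posDef_gram_add V hs
  have hMt : (V * Vᵀ + s • (1 : Matrix (Fin n) (Fin n) ℝ))ᵀ = V * Vᵀ + s • 1 := by
    simp
  -- The unknown is $U^\top$, with Hessian $VV^\top+s$. The push-through identity then rewrites the
  -- minimum through $V^\top V$, the only form that sees the right singular vectors of $V$.
  have h := complete_square_bound hM (Matrix.PosDef.one (n := Fin D) (R := ℝ)) Uᵀ (V * Zᵀ)
  have e1 : frobSq (U * V - Z) + s * trace (Uᵀ * U) = trace (Zᵀ * Z) +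
      (trace (Uᵀᵀ * (V * Vᵀ + s • 1) * Uᵀ * (1 : Matrix (Fin D) (Fin D) ℝ)) -
        2 * trace (Uᵀᵀ * (V * Zᵀ) * (1 : Matrix (Fin D) (Fin D) ℝ))) := by
    have a1 : trace (U * V * (Vᵀ * Uᵀ)) = trace (Vᵀ * Uᵀ * (U * V)) := trace_mul_comm _ _
    have a2 : trace (Vᵀ * Uᵀ * Z) = trace (U * V * Zᵀ) := by
      rw [← trace_transpose, transpose_mul, transpose_mul, transpose_transpose,
        transpose_transpose, trace_mul_comm]
    have a3 : trace (Zᵀ * (U * V)) = trace (U * V * Zᵀ) := trace_mul_comm _ _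
    have a4 : trace (U * Uᵀ) = trace (Uᵀ * U) := trace_mul_comm _ _
    rw [frobSq_eq_trace, transpose_sub, transpose_transpose, Matrix.mul_one, Matrix.mul_one,
      transpose_mul, Matrix.sub_mul, Matrix.mul_sub, Matrix.mul_sub, Matrix.mul_add,
      Matrix.add_mul, trace_sub, trace_sub, trace_sub, trace_add, a2, a3, ← a1,
      Matrix.mul_smul, Matrix.smul_mul, Matrix.mul_one, trace_smul, a4, ← Matrix.mul_assoc U V,
      ← Matrix.mul_assoc U V, ← Matrix.mul_assoc (U * V) Vᵀ, smul_eq_mul]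
    ring
  have e2 : trace ((V * Zᵀ)ᵀ * (V * Vᵀ + s • (1 : Matrix (Fin n) (Fin n) ℝ))⁻¹ * (V * Zᵀ) *
      (1 : Matrix (Fin D) (Fin D) ℝ)) =
      trace (Zᵀ * Z) - s * trace (Zᵀ * Z * (Vᵀ * V + s • 1)⁻¹) := by
    have := mul_gram_inv_mul Vᵀ hs
    rw [transpose_transpose] at this
    rw [Matrix.mul_one, transpose_mul, transpose_transpose, ← Matrix.mul_assoc, trace_mul_comm,
      Matrix.mul_assoc Z, Matrix.mul_assoc Z, this, ← Matrix.mul_assoc, Matrix.mul_sub,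
      Matrix.mul_one, trace_sub, Matrix.mul_smul, trace_smul, smul_eq_mul]
  rw [e1]
  rw [e2] at h
  refine ⟨by linarith [h.1], ?_⟩
  rw [show (trace (Zᵀ * Z) + (trace (Uᵀᵀ * (V * Vᵀ + s • 1) * Uᵀ *
      (1 : Matrix (Fin D) (Fin D) ℝ)) - 2 * trace (Uᵀᵀ * (V * Zᵀ) *
      (1 : Matrix (Fin D) (Fin D) ℝ))) = s * trace (Zᵀ * Z * (Vᵀ * V + s • 1)⁻¹)) ↔
      (trace (Uᵀᵀ * (V * Vᵀ + s • 1) * Uᵀ * (1 : Matrix (Fin D) (Fin D) ℝ)) -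
        2 * trace (Uᵀᵀ * (V * Zᵀ) * (1 : Matrix (Fin D) (Fin D) ℝ)) =
        -(trace (Zᵀ * Z) - s * trace (Zᵀ * Z * (Vᵀ * V + s • 1)⁻¹))) from
      ⟨fun e => by linarith, fun e => by linarith⟩, h.2]
  rw [← transpose_inj, transpose_transpose, transpose_mul, transpose_mul, transpose_nonsing_inv,
    hMt, transpose_transpose]

/-- Elimination of the second encoder. -/
theorem encoder_bound {n p : ℕ} {k : ℝ} (hk : 0 < k) {M : Matrix (Fin n) (Fin n) ℝ}
    (hM : M.PosDef) (U : Matrix (Fin n) (Fin p) ℝ) (W : Matrix (Fin p) (Fin n) ℝ) :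
    k * trace ((U * Uᵀ + k • 1)⁻¹ * M) ≤
        trace ((U * W - 1)ᵀ * (U * W - 1) * M) + k * trace (Wᵀ * W * M) ∧
      (trace ((U * W - 1)ᵀ * (U * W - 1) * M) + k * trace (Wᵀ * W * M) =
        k * trace ((U * Uᵀ + k • 1)⁻¹ * M) ↔ W = Uᵀ * (U * Uᵀ + k • 1)⁻¹) := by
  have hG := posDef_gram_add' U hk
  have hMt : Mᵀ = M := by simpa using hM.isHermitian.eq
  have h := complete_square_bound hG hM W Uᵀ
  have e1 : trace ((U * W - 1)ᵀ * (U * W - 1) * M) + k * trace (Wᵀ * W * M) = trace M +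
      (trace (Wᵀ * (Uᵀ * U + k • 1) * W * M) - 2 * trace (Wᵀ * Uᵀ * M)) := by
    have a1 : trace (U * W * M) = trace (Wᵀ * Uᵀ * M) := by
      rw [← trace_transpose, transpose_mul, transpose_mul, hMt, trace_mul_comm]
    rw [transpose_sub, transpose_one, transpose_mul, Matrix.sub_mul, Matrix.mul_sub,
      Matrix.mul_one, Matrix.one_mul, Matrix.mul_add, Matrix.add_mul, Matrix.mul_smul,
      Matrix.mul_one, Matrix.smul_mul, Matrix.sub_mul, Matrix.sub_mul, Matrix.sub_mul,
      Matrix.one_mul, Matrix.add_mul, Matrix.smul_mul, trace_sub, trace_sub, trace_sub, trace_add,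
      trace_smul, a1, smul_eq_mul, Matrix.mul_assoc Wᵀ Uᵀ, ← Matrix.mul_assoc Uᵀ U W,
      ← Matrix.mul_assoc Wᵀ]
    ring
  have e2 : trace (Uᵀᵀ * (Uᵀ * U + k • (1 : Matrix (Fin p) (Fin p) ℝ))⁻¹ * Uᵀ * M) =
      trace M - k * trace ((U * Uᵀ + k • 1)⁻¹ * M) := by
    rw [transpose_transpose, mul_gram_inv_mul U hk, Matrix.sub_mul, Matrix.one_mul, trace_sub,
      Matrix.smul_mul, trace_smul, smul_eq_mul]
  have e3 : Uᵀ * (U * Uᵀ + k • (1 : Matrix (Fin n) (Fin n) ℝ))⁻¹ =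
      (Uᵀ * U + k • (1 : Matrix (Fin p) (Fin p) ℝ))⁻¹ * Uᵀ := by
    simpa using mul_gram_inv Uᵀ hk
  rw [e1, e3]
  rw [e2] at h
  refine ⟨by linarith [h.1], ?_⟩
  rw [← h.2]
  exact ⟨fun e => by linarith, fun e => by linarith⟩

/-- Elimination of the second encoder variance. -/
theorem variance_bound {n : ℕ} {b e : ℝ} (hb : 0 < b) (he : 0 < e)
    {G S : Matrix (Fin n) (Fin n) ℝ} (hG : G.PosDef) (hS : S.PosDef) :
    e * n * (1 + Real.log (b / e)) + e * Real.log G.det ≤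
        b * trace (G * S) - e * Real.log S.det ∧
      (b * trace (G * S) - e * Real.log S.det =
        e * n * (1 + Real.log (b / e)) + e * Real.log G.det ↔ S = (e / b) • G⁻¹) := by
  have hbe : 0 < b / e := by positivity
  -- The scaling $b/e$ balances the trace against $e\log\det S$; equality means $(b/e)GS=1$.
  have h := log_det_add_log_det_le (hG.smul hbe) hS
  have hd := hG.det_pos
  have e1 : Real.log ((b / e) • G).det = n * Real.log (b / e) + Real.log G.det := by
    rw [det_smul, Real.log_mul (pow_pos hbe _).ne' hd.ne', Real.log_pow]; simp
  have e2 : trace ((b / e) • G * S) = b / e * trace (G * S) := by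
    rw [Matrix.smul_mul, trace_smul, smul_eq_mul]
  rw [e1, e2] at h
  have e3 : e * (b / e * trace (G * S)) = b * trace (G * S) := by field_simp
  have h1 := mul_le_mul_of_nonneg_left h.1 he.le
  have hu := PosDef.isUnit_det' hG
  refine ⟨by nlinarith [h1, e3], fun heq => ?_, fun heq => ?_⟩
  · have h2 := h.2 (by
      apply mul_left_cancel₀ he.ne'
      linarith [e3, heq])
    rw [Matrix.smul_mul] at h2
    have h3 : G * S = (e / b) • (1 : Matrix (Fin n) (Fin n) ℝ) := by
      rw [← h2, smul_smul, div_mul_div_cancel₀ hb.ne', div_self he.ne', one_smul]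
    rw [← nonsing_inv_mul_cancel_left G S hu, h3, Matrix.mul_smul, Matrix.mul_one]
  · have hS1 : trace (G * S) = e / b * n := by
      rw [heq, Matrix.mul_smul, mul_nonsing_inv _ hu, trace_smul, trace_one]; simp
    have hS2 : Real.log S.det = n * Real.log (e / b) - Real.log G.det := by
      rw [heq, det_smul, det_nonsing_inv, Ring.inverse_eq_inv',
        Real.log_mul (by positivity) (by positivity), Real.log_pow, Real.log_inv]; simp; ring
    have hl : Real.log (e / b) = -Real.log (b / e) := by rw [← Real.log_inv, inv_div]
    rw [hS1, hS2, hl]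
    field_simp
    ring

/-- Both determinants are, up to sign, characteristic polynomials at $-k$. The variance term
involves $U_2^\top U_2$ and the encoder term $U_2U_2^\top$; this merges them. -/
theorem det_gram_comm {n : ℕ} (U : Matrix (Fin n) (Fin n) ℝ) (k : ℝ) :
    (Uᵀ * U + k • (1 : Matrix (Fin n) (Fin n) ℝ)).det =
      (U * Uᵀ + k • (1 : Matrix (Fin n) (Fin n) ℝ)).det := by
  have key : ∀ A : Matrix (Fin n) (Fin n) ℝ, (A + k • 1).det = (-1) ^ n * (A.charpoly).eval (-k) := by
    intro A
    have h : scalar (Fin n) (-k) - A = -(A + k • (1 : Matrix (Fin n) (Fin n) ℝ)) := by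
      rw [scalar_apply, ← smul_one_eq_diagonal]
      module
    rw [Matrix.eval_charpoly, h, det_neg, Fintype.card_fin, ← mul_assoc, ← mul_pow]
    simp
  rw [key, key, charpoly_mul_comm]

theorem diagonalization_posDef {n : ℕ} {P : Matrix (Fin n) (Fin n) ℝ} {q : Fin n → ℝ}
    (hP : P ∈ Matrix.orthogonalGroup (Fin n) ℝ) (hq : ∀ i, 0 < q i) :
    (P * diagonal q * Pᵀ).PosDef := by
  have hi : Function.Injective P.vecMul :=
    Matrix.vecMul_injective_iff_isUnit.2 ((Matrix.isUnit_iff_isUnit_det P).2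
      (isUnit_det_of_left_inverse (orthogonal_transpose_mul hP)))
  simpa using (Matrix.PosDef.diagonal hq).mul_mul_conjTranspose_same hi

theorem det_diagonalization {n : ℕ} {P : Matrix (Fin n) (Fin n) ℝ} (q : Fin n → ℝ)
    (hP : P ∈ Matrix.orthogonalGroup (Fin n) ℝ) :
    (P * diagonal q * Pᵀ).det = ∏ i, q i := by
  rw [det_mul_comm, ← mul_assoc, orthogonal_transpose_mul hP, one_mul, det_diagonal]

theorem trace_mul_diagonalization {n : ℕ} (X P : Matrix (Fin n) (Fin n) ℝ) (q : Fin n → ℝ) :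
    trace (P * diagonal q * Pᵀ * X) = ∑ i, q i * (Pᵀ * X * P) i i := by
  rw [mul_assoc, mul_assoc, trace_mul_comm, mul_assoc, trace]
  simp [diagonal_mul]

theorem inv_diagonalization {n : ℕ} {P : Matrix (Fin n) (Fin n) ℝ} {q : Fin n → ℝ}
    (hP : P ∈ Matrix.orthogonalGroup (Fin n) ℝ) (hq : ∀ i, q i ≠ 0) :
    (P * diagonal q * Pᵀ)⁻¹ = P * diagonal (fun i => (q i)⁻¹) * Pᵀ := by
  apply inv_eq_right_inv
  calc _ = P * diagonal q * (Pᵀ * P) * diagonal (fun i => (q i)⁻¹) * Pᵀ := by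
        simp only [mul_assoc]
    _ = 1 := by
        rw [orthogonal_transpose_mul hP, mul_one, mul_assoc P, diagonal_mul_diagonal]
        simp [hq, orthogonal_mul_transpose hP]

/-- Elimination of the second decoder. -/
theorem second_decoder_bound {n : ℕ} {e k H : ℝ} (he : 0 < e) (hk : 0 < k)
    {M P : Matrix (Fin n) (Fin n) ℝ} {m : Fin n → ℝ}
    (hP : P ∈ Matrix.orthogonalGroup (Fin n) ℝ) (hM : M = P * diagonal m * Pᵀ)
    (U : Matrix (Fin n) (Fin n) ℝ) :
    ∑ i, e * (m i / H / max (m i / H) k + Real.log (max (m i / H) k)) ≤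
        e / H * trace ((U * Uᵀ + k • 1)⁻¹ * M) +
          e * Real.log (U * Uᵀ + k • (1 : Matrix (Fin n) (Fin n) ℝ)).det ∧
      (e / H * trace ((U * Uᵀ + k • 1)⁻¹ * M) +
          e * Real.log (U * Uᵀ + k • (1 : Matrix (Fin n) (Fin n) ℝ)).det =
        ∑ i, e * (m i / H / max (m i / H) k + Real.log (max (m i / H) k)) ↔
        U * Uᵀ + k • 1 = P * diagonal (fun i => max (m i / H) k) * Pᵀ) := by
  set B := U * Uᵀ + k • (1 : Matrix (Fin n) (Fin n) ℝ) with hBdef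
  have hB : B.PosDef := posDef_gram_add U hk
  set q : Fin n → ℝ := fun i => max (m i / H) k with hq
  have hq0 : ∀ i, 0 < q i := fun i => lt_max_of_lt_right hk
  set x : Fin n → ℝ := fun i => (Pᵀ * B⁻¹ * P) i i with hx
  have hxk : ∀ i, x i ≤ 1 / k := by
    intro i
    -- This is $1-kB^{-1}\succeq0$ in disguise: the constraint $B\succeq k$ bounds the diagonal of
    -- $P^\top B^{-1}P$ by $1/k$.
    have h1 : (Pᵀ * (U * (Uᵀ * U + k • 1)⁻¹ * Uᵀ) * P).PosSemidef := by
      have := ((posDef_gram_add' U hk).inv.posSemidef.mul_mul_conjTranspose_same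
        U).conjTranspose_mul_mul_same P
      simpa using this
    rw [mul_gram_inv_mul U hk, ← hBdef, Matrix.mul_sub, Matrix.sub_mul, Matrix.mul_one,
      orthogonal_transpose_mul hP, Matrix.mul_smul, Matrix.smul_mul] at h1
    have h2 := h1.diag_nonneg (i := i)
    simp only [Matrix.sub_apply, one_apply_eq, Matrix.smul_apply, smul_eq_mul] at h2
    rw [le_div_iff₀ hk]
    linarith [show (Pᵀ * B⁻¹ * P) i i = x i from rfl]
  have htM : trace (B⁻¹ * M) = ∑ i, m i * x i := by
    rw [trace_mul_comm, hM, trace_mul_diagonalization]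
  -- Bounding $\log\det B$ by its tangent in $B^{-1}$ at the candidate leaves $(m_i/H-q_i)x_i+1+\log
  -- q_i$. The coefficient of $x_i$ is zero when $m_i/H\ge k$; otherwise it is nonpositive and
  -- $x_i\le1/k$ finishes.
  have hlog := log_det_add_log_det_le (diagonalization_posDef hP hq0) hB.inv
  have hdB : Real.log (B⁻¹).det = -Real.log B.det := by
    rw [det_nonsing_inv, Ring.inverse_eq_inv', Real.log_inv]
  rw [det_diagonalization q hP, Real.log_prod (fun i _ => (hq0 i).ne'), hdB,
    trace_mul_diagonalization] at hlog
  have hterm : ∀ i ∈ Finset.univ, m i / H / q i + Real.log (q i) ≤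
      m i / H * x i - q i * x i + 1 + Real.log (q i) := by
    intro i _
    have h1 : m i / H / q i ≤ m i / H * x i - q i * x i + 1 := by
      rw [div_le_iff₀ (hq0 i)]
      rcases le_total k (m i / H) with h | h
      · have : q i = m i / H := max_eq_left h
        rw [this]; linarith
      · have hqk : q i = k := max_eq_right h
        rw [hqk]
        have := hxk i
        rw [le_div_iff₀ hk] at this
        nlinarith
    linarith
  have hsum := Finset.sum_le_sum hterm
  have hsum' : ∑ i, (m i / H * x i - q i * x i + 1 + Real.log (q i)) =
      (∑ i, m i * x i) / H - ∑ i, q i * x i + n + ∑ i, Real.log (q i) := by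
    rw [Finset.sum_add_distrib, Finset.sum_add_distrib, Finset.sum_sub_distrib, Finset.sum_div]
    simp [div_mul_eq_mul_div]
  rw [hsum'] at hsum
  rw [htM, ← Finset.mul_sum]
  have e1 : e / H * ∑ i, m i * x i = e * ((∑ i, m i * x i) / H) := by ring
  rw [e1, ← mul_add]
  refine ⟨mul_le_mul_of_nonneg_left (by linarith [hlog.1]) he.le, fun heq => ?_, fun heq => ?_⟩
  · have h1 := mul_left_cancel₀ he.ne' heq
    have h2 := hlog.2 (by
      have := hlog.1
      apply le_antisymm this
      linarith)
    have h3 := congrArg (fun A => A * B) h2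
    simp only [one_mul] at h3
    rw [nonsing_inv_mul_cancel_right _ _ (PosDef.isUnit_det' hB)] at h3
    exact h3.symm
  · have hxq : ∀ i, x i = (q i)⁻¹ := by
      intro i
      rw [hx, heq, inv_diagonalization hP (fun i => (hq0 i).ne')]
      have : Pᵀ * (P * diagonal (fun i => (q i)⁻¹) * Pᵀ) * P =
          (Pᵀ * P) * diagonal (fun i => (q i)⁻¹) * (Pᵀ * P) := by simp only [mul_assoc]
      simp only [this, orthogonal_transpose_mul hP]
      simp
    congr 1
    rw [heq, det_diagonalization q hP, Real.log_prod (fun i _ => (hq0 i).ne'), Finset.sum_div,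
      ← Finset.sum_add_distrib]
    refine Finset.sum_congr rfl fun i _ => ?_
    rw [hxq]
    show _ = m i / H / q i + Real.log (q i)
    ring

/-! ### The scalar problem -/

/-- The variance profile left after eliminating the second latent layer (in relative units). -/
noncomputable def profile (r : ℝ) : ℝ := r / max r 1 + Real.log (max r 1)

theorem profile_of_le {r : ℝ} (h : r ≤ 1) : profile r = r := by
  simp [profile, max_eq_right h]

theorem profile_of_ge {r : ℝ} (h : 1 ≤ r) : profile r = 1 + Real.log r := by
  have : r ≠ 0 := by positivity
  simp [profile, max_eq_left h, this]

/-- The minimizer over `m ≥ s` of `u / m + profile (m / τ)`. -/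
noncomputable def optVar (s τ u : ℝ) : ℝ :=
  if max s τ ≤ u then u else max s (if τ ≤ s then s else Real.sqrt (u * τ))

theorem le_optVar (s τ u : ℝ) : s ≤ optVar s τ u := by
  unfold optVar
  split_ifs with h
  · exact (le_max_left _ _).trans h
  · exact le_max_left _ _
  · exact le_max_left _ _

theorem one_sub_inv_lt_log {x : ℝ} (hx : 0 < x) (h1 : x ≠ 1) : 1 - x⁻¹ < Real.log x := by
  have := Real.log_lt_sub_one_of_pos (inv_pos.2 hx) (by simpa using h1)
  rw [Real.log_inv] at this
  linarith

/-- The slope is $-u/m^2+1/\tau$ below $\tau$ and $-u/m^2+1/m$ above, so the critical points are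
$\sqrt{u\tau}$ and $u$, which lie on the same side of $\tau$. The value there, or at the boundary
$s$, is compared directly using $\log x\le x-1$. -/
theorem optVar_lt {s τ u m : ℝ} (hs : 0 < s) (hτ : 0 < τ) (hu : 0 ≤ u) (hm : s ≤ m)
    (hne : m ≠ optVar s τ u) :
    u / optVar s τ u + profile (optVar s τ u / τ) < u / m + profile (m / τ) := by
  have hm0 : 0 < m := hs.trans_le hm
  unfold optVar at hne ⊢
  split_ifs at hne ⊢ with h1 h2
  · have hsu := (le_max_left _ _).trans h1
    have hτu : τ ≤ u := (le_max_right _ _).trans h1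
    have hu0 : 0 < u := hs.trans_le hsu
    rw [profile_of_ge ((one_le_div hτ).2 hτu), div_self hu0.ne']
    rcases le_total τ m with hτm | hτm
    · rw [profile_of_ge ((one_le_div hτ).2 hτm), Real.log_div hm0.ne' hτ.ne',
        Real.log_div hu0.ne' hτ.ne']
      have h := Real.log_lt_sub_one_of_pos (div_pos hu0 hm0) (by
        rw [Ne, div_eq_one_iff_eq hm0.ne']; exact fun h => hne h.symm)
      rw [Real.log_div hu0.ne' hm0.ne'] at h
      linarith
    · rw [profile_of_le ((div_le_one hτ).2 hτm)]
      have hl := Real.log_le_sub_one_of_pos (div_pos hu0 hτ)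
      have hmu : m < u := lt_of_le_of_ne (hτm.trans hτu) hne
      rcases hτm.eq_or_lt with heq | hlt
      · subst heq
        have hl := Real.log_lt_sub_one_of_pos (div_pos hu0 hτ) (by
          rw [Ne, div_eq_one_iff_eq hτ.ne']; exact fun h => hne h.symm)
        rw [div_self hτ.ne']; linarith
      · have : 0 < (τ - m) * (u - m) / (m * τ) :=
          div_pos (mul_pos (by linarith) (by linarith)) (by positivity)
        have e : (τ - m) * (u - m) / (m * τ) = u / m + m / τ - 1 - u / τ := by
          field_simp; ring
        linarith
  · have hus : u < s := by
      rw [not_le, max_eq_left h2] at h1; exact h1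
    rw [max_self] at hne ⊢
    have hsm : s < m := lt_of_le_of_ne hm (Ne.symm hne)
    rw [profile_of_ge ((one_le_div hτ).2 h2), profile_of_ge ((one_le_div hτ).2 (h2.trans hm)),
      Real.log_div hm0.ne' hτ.ne', Real.log_div hs.ne' hτ.ne']
    have h := one_sub_inv_lt_log (div_pos hm0 hs) (by
      rw [Ne, div_eq_one_iff_eq hs.ne']; exact hne)
    rw [Real.log_div hm0.ne' hs.ne', inv_div] at h
    have e : (1 - s / m) * (1 - u / s) = 1 - s / m - u / s + u / m := by
      field_simp; ring
    have : 0 ≤ (1 - s / m) * (1 - u / s) :=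
      mul_nonneg (sub_nonneg.2 ((div_le_one hm0).2 hm)) (sub_nonneg.2 ((div_le_one hs).2 hus.le))
    linarith
  · rw [not_le] at h2
    have huτ : u < τ := by
      rw [not_le, max_eq_right h2.le] at h1; exact h1
    set z := Real.sqrt (u * τ) with hz
    have hz0 : 0 ≤ z := Real.sqrt_nonneg _
    have hzz : z * z = u * τ := Real.mul_self_sqrt (by positivity)
    have hzτ : z < τ := by
      by_contra h
      rw [not_lt] at h
      nlinarith
    set w := max s z with hw
    have hwτ : w < τ := max_lt h2 hzτ
    have hsw : s ≤ w := le_max_left _ _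
    have hzw : z ≤ w := le_max_right _ _
    have hw0 : 0 < w := hs.trans_le hsw
    -- The linear branch, on all of $m'\ge s$; it is also used at $m'=\tau$ to pass the kink.
    have key : ∀ m', s ≤ m' → m' ≠ w → u / w + w / τ < u / m' + m' / τ := by
      intro m' hm' hne'
      have hm0' : 0 < m' := hs.trans_le hm'
      have e : u / m' + m' / τ - (u / w + w / τ) =
          (m' - w) * (m' * w - u * τ) / (m' * w * τ) := by
        field_simp; ring
      have hp : 0 < (m' - w) * (m' * w - u * τ) := by
        rcases le_total s z with hsz | hsz
        · have hwz : w = z := max_eq_right hsz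
          rw [← hzz, ← hwz]
          have : (m' - w) * (m' * w - w * w) = w * (m' - w) ^ 2 := by ring
          rw [this]
          exact mul_pos hw0 (sq_pos_of_ne_zero (sub_ne_zero.2 hne'))
        · have hws : w = s := max_eq_left hsz
          have hlt : w < m' := lt_of_le_of_ne (hws ▸ hm') (Ne.symm hne')
          rw [← hzz]
          have : z * z ≤ w * w := mul_le_mul hzw hzw hz0 hw0.le
          exact mul_pos (by linarith) (by nlinarith)
      have : 0 < (m' - w) * (m' * w - u * τ) / (m' * w * τ) := div_pos hp (by positivity)
      linarith
    rw [profile_of_le ((div_le_one hτ).2 hwτ.le)]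
    rcases le_total m τ with hmτ | hmτ
    · rw [profile_of_le ((div_le_one hτ).2 hmτ)]
      exact key m hm hne
    · have h3 := key τ h2.le hwτ.ne'
      rw [profile_of_ge ((one_le_div hτ).2 hmτ)]
      have hl := Real.one_sub_inv_le_log_of_pos (div_pos hm0 hτ)
      rw [inv_div] at hl
      have e : (1 - τ / m) * (1 - u / τ) = 1 - τ / m - u / τ + u / m := by
        field_simp; ring
      have : 0 ≤ (1 - τ / m) * (1 - u / τ) :=
        mul_nonneg (sub_nonneg.2 ((div_le_one hm0).2 hmτ))
          (sub_nonneg.2 ((div_le_one hτ).2 huτ.le))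
      rw [div_self hτ.ne'] at h3
      linarith

theorem optVar_le {s τ u m : ℝ} (hs : 0 < s) (hτ : 0 < τ) (hu : 0 ≤ u) (hm : s ≤ m) :
    u / optVar s τ u + profile (optVar s τ u / τ) ≤ u / m + profile (m / τ) := by
  by_cases h : m = optVar s τ u
  · rw [← h]
  · exact (optVar_lt hs hτ hu hm h).le

/-- The closed-form expressions for the singular values of the optimal `V₁` and `U₂`. -/
theorem optimal_singular_values_iff {β₁ β₂ ηenc ηdec σ₁ θ l w : ℝ} (hβ₁ : 0 < β₁) (hβ₂ : 0 < β₂)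
    (hηenc : 0 < ηenc) (hηdec : 0 < ηdec) (hσ₁ : 0 < σ₁) (hθ : 0 ≤ θ) :
    ((β₂ * ηdec ^ 2 / σ₁ ^ 2 * max (σ₁ ^ 2) (β₂ / β₁ * ηdec ^ 2) ≤ θ ^ 2 →
        l = σ₁ / (Real.sqrt β₂ * ηdec) * Real.sqrt (θ ^ 2 - β₂ * ηdec ^ 2) ∧
        w = Real.sqrt (σ₁ ^ 2 * θ ^ 2 / (β₂ * ηenc ^ 2 * ηdec ^ 2)
          - β₂ / β₁ * (ηdec ^ 2 / ηenc ^ 2))) ∧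
      (θ ^ 2 < β₂ * ηdec ^ 2 / σ₁ ^ 2 * max (σ₁ ^ 2) (β₂ / β₁ * ηdec ^ 2) →
        β₂ / β₁ * ηdec ^ 2 ≤ σ₁ ^ 2 →
        l = 0 ∧ w = Real.sqrt ((σ₁ ^ 2 - β₂ / β₁ * ηdec ^ 2) / ηenc ^ 2)) ∧
      (θ ^ 2 < β₂ * ηdec ^ 2 / σ₁ ^ 2 * max (σ₁ ^ 2) (β₂ / β₁ * ηdec ^ 2) →
        σ₁ ^ 2 < β₂ / β₁ * ηdec ^ 2 →
        l = Real.sqrt (max 0 (σ₁ / Real.sqrt β₁ * (θ - Real.sqrt β₁ * σ₁))) ∧ w = 0)) ↔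
    l = Real.sqrt (optVar (σ₁ ^ 2) (β₂ / β₁ * ηdec ^ 2)
        (σ₁ ^ 2 * θ ^ 2 / (β₂ * ηdec ^ 2)) - σ₁ ^ 2) ∧
      w = Real.sqrt (max (optVar (σ₁ ^ 2) (β₂ / β₁ * ηdec ^ 2)
        (σ₁ ^ 2 * θ ^ 2 / (β₂ * ηdec ^ 2)) / ηenc ^ 2) ((ηdec / ηenc) ^ 2 * (β₂ / β₁)) -
          (ηdec / ηenc) ^ 2 * (β₂ / β₁)) := by
  set τ := β₂ / β₁ * ηdec ^ 2 with hτd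
  have hτ : 0 < τ := by positivity
  set u := σ₁ ^ 2 * θ ^ 2 / (β₂ * ηdec ^ 2) with hu
  have hkτ : (ηdec / ηenc) ^ 2 * (β₂ / β₁) = τ / ηenc ^ 2 := by
    rw [hτd]; field_simp
  have hmax : ∀ m, max (m / ηenc ^ 2) (τ / ηenc ^ 2) - τ / ηenc ^ 2 = (max m τ - τ) / ηenc ^ 2 := by
    intro m
    rw [max_div_div_right (by positivity), sub_div]
  rw [hkτ, hmax]
  -- The threshold on $\theta^2$ is the condition $\max(s,\tau)\le u$ that defines the first branch
  -- of `optVar`.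
  have hcond : β₂ * ηdec ^ 2 / σ₁ ^ 2 * max (σ₁ ^ 2) τ ≤ θ ^ 2 ↔ max (σ₁ ^ 2) τ ≤ u := by
    rw [hu, le_div_iff₀ (by positivity), div_mul_eq_mul_div, div_le_iff₀ (by positivity),
      mul_comm (max _ _), mul_comm (θ ^ 2)]
  have hcond' : θ ^ 2 < β₂ * ηdec ^ 2 / σ₁ ^ 2 * max (σ₁ ^ 2) τ ↔ ¬ max (σ₁ ^ 2) τ ≤ u := by
    rw [← hcond, not_le]
  rw [hcond', hcond]
  by_cases h1 : max (σ₁ ^ 2) τ ≤ u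
  · have hτu : τ ≤ u := (le_max_right _ _).trans h1
    have ho : optVar (σ₁ ^ 2) τ u = u := if_pos h1
    have e1 : σ₁ / (Real.sqrt β₂ * ηdec) * Real.sqrt (θ ^ 2 - β₂ * ηdec ^ 2) =
        Real.sqrt (u - σ₁ ^ 2) := by
      have : u - σ₁ ^ 2 = (σ₁ / (Real.sqrt β₂ * ηdec)) ^ 2 * (θ ^ 2 - β₂ * ηdec ^ 2) := by
        rw [hu, div_pow, mul_pow, Real.sq_sqrt hβ₂.le]; field_simp
      rw [this, Real.sqrt_mul (sq_nonneg _), Real.sqrt_sq (by positivity)]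
    have e2 : σ₁ ^ 2 * θ ^ 2 / (β₂ * ηenc ^ 2 * ηdec ^ 2) - β₂ / β₁ * (ηdec ^ 2 / ηenc ^ 2) =
        (max u τ - τ) / ηenc ^ 2 := by
      rw [max_eq_left hτu, hu, hτd]; field_simp
    rw [ho, e1, e2]
    simp [h1]
  · by_cases h2 : τ ≤ σ₁ ^ 2
    · have ho : optVar (σ₁ ^ 2) τ u = σ₁ ^ 2 := by
        rw [optVar, if_neg h1, if_pos h2, max_self]
      rw [max_eq_left h2] at h1
      rw [ho, max_eq_left h2]
      simp only [h1, h2, not_lt.2 h2, not_false_eq_true, false_implies, true_implies, true_and,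
        implies_true, and_true, sub_self, Real.sqrt_zero]
    · have ho : optVar (σ₁ ^ 2) τ u = max (σ₁ ^ 2) (σ₁ * θ / Real.sqrt β₁) := by
        rw [optVar, if_neg h1, if_neg h2]
        congr 1
        rw [show u * τ = (σ₁ * θ / Real.sqrt β₁) ^ 2 by
          rw [div_pow, Real.sq_sqrt hβ₁.le, hu, hτd]; field_simp]
        exact Real.sqrt_sq (by positivity)
      rw [not_le] at h2
      -- The optimal variance stays below the kink, so the second decoder is switched off:
      -- $\omega=0$.
      have hoτ : optVar (σ₁ ^ 2) τ u ≤ τ := by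
        rw [not_le, max_eq_right h2.le] at h1
        rw [optVar, if_neg (by rw [not_le, max_eq_right h2.le]; exact h1), if_neg (not_le.2 h2)]
        refine max_le h2.le (Real.sqrt_le_iff.2 ⟨hτ.le, ?_⟩)
        rw [sq]; exact mul_le_mul_of_nonneg_right h1.le hτ.le
      have e1 : max 0 (σ₁ / Real.sqrt β₁ * (θ - Real.sqrt β₁ * σ₁)) =
          optVar (σ₁ ^ 2) τ u - σ₁ ^ 2 := by
        have hb : Real.sqrt β₁ ≠ 0 := (Real.sqrt_pos.2 hβ₁).ne'
        rw [ho, ← max_sub_sub_right, sub_self]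
        congr 1
        field_simp
      rw [e1, max_eq_right hoτ]
      simp only [h1, h2, not_le.2 h2, not_false_eq_true, false_implies, true_implies, true_and,
        sub_self, zero_div, Real.sqrt_zero]

/-! ### Rectangular diagonal matrices -/

theorem rectDiag_mul_transpose {m n : ℕ} (h : m ≤ n) (a : ℕ → ℝ) :
    rectDiag m n a * (rectDiag m n a)ᵀ = diagonal (fun i : Fin m => a i ^ 2) := by
  ext i j
  rw [mul_apply, diagonal_apply, Finset.sum_eq_single (Fin.castLE h i)]
  · by_cases hij : i = j
    · subst hij; simp [rectDiag, sq]
    · have : ¬ (j : ℕ) = i := fun h => hij (Fin.ext h.symm)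
      simp [rectDiag, hij, this]
  · intro k _ hk
    have : ¬ (i : ℕ) = k := fun h => hk (Fin.ext h.symm)
    simp [rectDiag, this]
  · simp

theorem transpose_rectDiag (m n : ℕ) (a : ℕ → ℝ) : (rectDiag m n a)ᵀ = rectDiag n m a := by
  ext i j
  simp only [rectDiag, transpose_apply, of_apply]
  by_cases h : (j : ℕ) = i
  · rw [if_pos h, if_pos h.symm, h]
  · rw [if_neg h, if_neg (Ne.symm h)]

theorem transpose_mul_rectDiag (m n : ℕ) (a : ℕ → ℝ) :
    (rectDiag m n a)ᵀ * rectDiag m n a =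
      diagonal (fun i : Fin n => if (i : ℕ) < m then a i ^ 2 else 0) := by
  ext i j
  rw [mul_apply, diagonal_apply]
  by_cases hi : (i : ℕ) < m
  · rw [Finset.sum_eq_single ⟨i, hi⟩]
    · by_cases hij : i = j
      · subst hij; simp [rectDiag, sq, hi]
      · have : ¬ (i : ℕ) = j := fun h => hij (Fin.ext h)
        simp [rectDiag, hij, this]
    · intro k _ hk
      have : ¬ (k : ℕ) = i := fun h => hk (Fin.ext h)
      simp [rectDiag, this]
    · simp
  · rw [if_neg hi, ite_self]
    refine Finset.sum_eq_zero fun k _ => ?_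
    have : ¬ (k : ℕ) = i := by have := k.2; omega
    simp [rectDiag, this]

theorem gram_of_svd {m n : ℕ} {V : Matrix (Fin m) (Fin n) ℝ} {P : Matrix (Fin m) (Fin m) ℝ}
    {S : Matrix (Fin n) (Fin n) ℝ} {a : ℕ → ℝ} (hP : P ∈ Matrix.orthogonalGroup (Fin m) ℝ)
    (h : V = P * rectDiag m n a * Sᵀ) :
    Vᵀ * V = S * diagonal (fun i : Fin n => if (i : ℕ) < m then a i ^ 2 else 0) * Sᵀ := by
  rw [← transpose_mul_rectDiag, h]
  simp only [transpose_mul, transpose_transpose, Matrix.mul_assoc]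
  rw [← Matrix.mul_assoc Pᵀ, orthogonal_transpose_mul hP, Matrix.one_mul]

theorem gram_of_svd' {m n : ℕ} {V : Matrix (Fin m) (Fin n) ℝ} {P : Matrix (Fin m) (Fin m) ℝ}
    {S : Matrix (Fin n) (Fin n) ℝ} {a : ℕ → ℝ} (hmn : m ≤ n)
    (hS : S ∈ Matrix.orthogonalGroup (Fin n) ℝ) (h : V = P * rectDiag m n a * Sᵀ) :
    V * Vᵀ = P * diagonal (fun i : Fin m => a i ^ 2) * Pᵀ := by
  rw [← rectDiag_mul_transpose hmn, h]
  simp only [transpose_mul, transpose_transpose, Matrix.mul_assoc]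
  rw [← Matrix.mul_assoc Sᵀ, orthogonal_transpose_mul hS, Matrix.one_mul]

theorem diagonalization_add_smul_one {n : ℕ} {S : Matrix (Fin n) (Fin n) ℝ} (t : Fin n → ℝ) (s : ℝ)
    (hS : S ∈ Matrix.orthogonalGroup (Fin n) ℝ) :
    S * diagonal t * Sᵀ + s • 1 = S * diagonal (fun i => t i + s) * Sᵀ := by
  have : diagonal (fun i => t i + s) = diagonal t + s • (1 : Matrix (Fin n) (Fin n) ℝ) := by
    rw [smul_one_eq_diagonal, diagonal_add]
  rw [this, mul_add, add_mul, Matrix.mul_smul, Matrix.smul_mul, mul_one,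
    orthogonal_mul_transpose hS]

theorem IsSVD.gram {m n : ℕ} {Z : Matrix (Fin m) (Fin n) ℝ} {R : Matrix (Fin m) (Fin m) ℝ}
    {θ : ℕ → ℝ} {S : Matrix (Fin n) (Fin n) ℝ} (h : IsSVD Z R θ S) :
    Zᵀ * Z = S * diagonal (fun i : Fin n => θ i ^ 2) * Sᵀ := by
  rw [gram_of_svd h.left_orthogonal h.eq]
  congr 3
  funext i
  split_ifs with hi
  · rfl
  · rw [h.eq_zero i (min_le_of_left_le (not_lt.1 hi))]; simp

theorem IsSVD.singularValues_unique {m n : ℕ} {Z : Matrix (Fin m) (Fin n) ℝ}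
    {R R' : Matrix (Fin m) (Fin m) ℝ} {θ θ' : ℕ → ℝ} {S S' : Matrix (Fin n) (Fin n) ℝ}
    (h : IsSVD Z R θ S) (h' : IsSVD Z R' θ' S') : θ = θ' := by
  have hanti : ∀ {R θ S}, IsSVD Z R θ S → Antitone (fun i : Fin n => θ i ^ 2) :=
    fun h i j hij => pow_le_pow_left₀ (h.nonneg _) (h.antitone hij) 2
  have := diagonalization_unique h.right_orthogonal h'.right_orthogonal (hanti h) (hanti h')
    (by rw [← h.gram, ← h'.gram])
  funext i
  by_cases hi : i < n
  · exact (pow_left_inj₀ (h.nonneg i) (h'.nonneg i) two_ne_zero).1 (congrFun this ⟨i, hi⟩)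
  · rw [h.eq_zero i (min_le_of_right_le (not_lt.1 hi)),
      h'.eq_zero i (min_le_of_right_le (not_lt.1 hi))]

/-- Extension of a finite sequence by zero. -/
noncomputable def extendZero {n : ℕ} (t : Fin n → ℝ) (i : ℕ) : ℝ := if h : i < n then t ⟨i, h⟩ else 0

theorem extendZero_apply {n : ℕ} (t : Fin n → ℝ) (i : Fin n) : extendZero t i = t i := by
  simp [extendZero]

theorem extendZero_nonneg {n : ℕ} {t : Fin n → ℝ} (h : ∀ i, 0 ≤ t i) (i : ℕ) :
    0 ≤ extendZero t i := by
  unfold extendZero; split_ifs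
  · exact h _
  · exact le_rfl

theorem extendZero_antitone {n : ℕ} {t : Fin n → ℝ} (ht : Antitone t) (h : ∀ i, 0 ≤ t i) :
    Antitone (extendZero t) := by
  intro i j hij
  by_cases hj : j < n
  · have hi : i < n := hij.trans_lt hj
    simp only [extendZero, hi, hj, dif_pos]
    exact ht hij
  · have : extendZero t j = 0 := dif_neg hj
    rw [this]
    exact extendZero_nonneg h i

theorem diagonalization_gram_nonneg {m n : ℕ} {V : Matrix (Fin m) (Fin n) ℝ}
    {S : Matrix (Fin n) (Fin n) ℝ} {t : Fin n → ℝ} (hS : S ∈ Matrix.orthogonalGroup (Fin n) ℝ)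
    (h : Vᵀ * V = S * diagonal t * Sᵀ) (i : Fin n) : 0 ≤ t i := by
  have h1 : ((V * S)ᵀ * (V * S)).PosSemidef := by
    simpa using Matrix.posSemidef_conjTranspose_mul_self (V * S)
  have h2 : (V * S)ᵀ * (V * S) = diagonal t := by
    rw [transpose_mul, Matrix.mul_assoc, ← Matrix.mul_assoc Vᵀ, h]
    simp only [mul_assoc, orthogonal_transpose_mul hS, mul_one]
    rw [← mul_assoc, orthogonal_transpose_mul hS, one_mul]
  rw [h2] at h1
  exact Matrix.posSemidef_diagonal_iff.1 h1 i

/-- A sorted diagonalization of `Zᵀ Z` extends to a singular value decomposition of `Z`. -/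
theorem exists_isSVD {m n : ℕ} {Z : Matrix (Fin m) (Fin n) ℝ} {S : Matrix (Fin n) (Fin n) ℝ}
    {t : Fin n → ℝ} (hS : S ∈ Matrix.orthogonalGroup (Fin n) ℝ) (ht : Antitone t)
    (h : Zᵀ * Z = S * diagonal t * Sᵀ) :
    ∃ R θ, IsSVD Z R θ S := by
  have h0 := diagonalization_gram_nonneg hS h
  have hx := extendZero_antitone ht h0
  obtain ⟨⟨R, hR, hZ⟩, hzero⟩ := exists_left_factor hS hx (by
    simp only [extendZero_apply]; exact h)
  refine ⟨R, _, hR, hS, fun i j hij => Real.sqrt_le_sqrt (hx hij), fun i => Real.sqrt_nonneg _,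
    fun i hi => ?_, hZ⟩
  by_cases hin : i < n
  · rw [hzero i (by omega) hin, Real.sqrt_zero]
  · simp [extendZero, hin]

/-! ### The reduced loss -/

/-- The loss, rescaled by `η_dec²`, up to a constant. -/
noncomputable def coreLoss {D d n p : ℕ} (b e k s : ℝ) (Z : Matrix (Fin D) (Fin d) ℝ)
    (U₁ : Matrix (Fin D) (Fin n) ℝ) (U₂ : Matrix (Fin n) (Fin p) ℝ) (V : Matrix (Fin n) (Fin d) ℝ)
    (W : Matrix (Fin p) (Fin n) ℝ) (S₂ : Matrix (Fin p) (Fin p) ℝ) : ℝ :=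
  (frobSq (U₁ * V - Z) + s * trace (U₁ᵀ * U₁)) +
    b * (trace ((U₂ * W - 1)ᵀ * (U₂ * W - 1) * (V * Vᵀ + s • 1)) +
      k * trace (Wᵀ * W * (V * Vᵀ + s • 1))) +
    (b * trace ((U₂ᵀ * U₂ + k • 1) * S₂) - e * Real.log S₂.det)

theorem frobSq_mul_eq_trace {a m n : ℕ} (X : Matrix (Fin a) (Fin m) ℝ)
    (V : Matrix (Fin m) (Fin n) ℝ) :
    frobSq (X * V) = trace (Xᵀ * X * (V * Vᵀ)) := by
  rw [frobSq_eq_trace, transpose_mul, Matrix.mul_assoc, trace_mul_comm]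
  simp only [Matrix.mul_assoc]

/-- Since $\Sigma_1=s\,I$, the terms in $V$ and $\Sigma_1$ pair up into traces against $VV^\top+s$;
moreover $\beta_2c^2=\beta_1k$. -/
theorem loss_eq_coreLoss {D₀ d₀ d₁ d₂ : ℕ} {β₁ β₂ ηenc ηdec σ₁ : ℝ} (hβ₁ : β₁ ≠ 0)
    (hηdec : ηdec ≠ 0) (Z : Matrix (Fin D₀) (Fin d₀) ℝ)
    (U1 : Matrix (Fin D₀) (Fin d₁) ℝ) (U2 : Matrix (Fin d₁) (Fin d₂) ℝ)
    (V1 : Matrix (Fin d₁) (Fin d₀) ℝ) (W2 : Matrix (Fin d₂) (Fin d₁) ℝ)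
    (S2 : Matrix (Fin d₂) (Fin d₂) ℝ) :
    loss β₁ β₂ ηenc ηdec Z U1 U2 V1 W2 (σ₁ ^ 2 • 1) S2 =
      1 / ηdec ^ 2 * coreLoss β₁ (β₂ * ηdec ^ 2) ((ηdec / ηenc) ^ 2 * (β₂ / β₁)) (σ₁ ^ 2)
        Z U1 U2 V1 W2 S2 -
      β₁ * Real.log (σ₁ ^ 2 • (1 : Matrix (Fin d₁) (Fin d₁) ℝ)).det := by
  unfold loss coreLoss
  rw [frobSq_mul_eq_trace, frobSq_mul_eq_trace]
  simp only [Matrix.mul_add, Matrix.add_mul, Matrix.mul_smul, Matrix.smul_mul, Matrix.mul_one,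
    Matrix.one_mul, trace_add, trace_smul, smul_eq_mul]
  field_simp
  ring

/-- The smallest value of `coreLoss`, as a function of the singular values of the data matrix. -/
noncomputable def optLoss (b e k H s : ℝ) (n d : ℕ) (θ : ℕ → ℝ) : ℝ :=
  ∑ i ∈ Finset.range n, e * (s * θ i ^ 2 / e / optVar s (k * H) (s * θ i ^ 2 / e) +
      profile (optVar s (k * H) (s * θ i ^ 2 / e) / (k * H))) +
    ∑ i ∈ Finset.Ico n d, θ i ^ 2 + (n * (e * Real.log k) + e * n * (1 + Real.log (b / e)))

theorem profile_scale {m k H : ℝ} (hk : 0 < k) :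
    m / H / max (m / H) k + Real.log (max (m / H) k) = profile (m / (k * H)) + Real.log k := by
  have h1 : m / H = k * (m / (k * H)) := by
    rw [mul_comm k H, ← div_div, mul_div_cancel₀ _ hk.ne']
  have h2 : max (m / H) k = k * max (m / (k * H)) 1 := by
    rw [mul_max_of_nonneg _ _ hk.le, mul_one, ← h1]
  have h3 : 0 < max (m / (k * H)) 1 := lt_max_of_lt_right one_pos
  rw [h2, Real.log_mul hk.ne' h3.ne', profile]
  nth_rw 1 [h1]
  rw [mul_div_mul_left _ _ hk.ne']
  ring

/-- Lower bound for the loss when the first encoder is aligned with the singular vectors of `Z`,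
with its equality case. -/
theorem optLoss_le_coreLoss_of_aligned {D d n : ℕ} {b e k H s : ℝ} (hb : 0 < b) (he : 0 < e)
    (hk : 0 < k) (hH : 0 < H) (hs : 0 < s) (hbkH : b * k * H = e) (hnd : n ≤ d)
    {Z : Matrix (Fin D) (Fin d) ℝ} {R : Matrix (Fin D) (Fin D) ℝ} {θ : ℕ → ℝ}
    {S : Matrix (Fin d) (Fin d) ℝ} (hsvd : IsSVD Z R θ S) {P : Matrix (Fin n) (Fin n) ℝ}
    (hP : P ∈ Matrix.orthogonalGroup (Fin n) ℝ) {V : Matrix (Fin n) (Fin d) ℝ} {lam : ℕ → ℝ}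
    (hV : V = P * rectDiag n d lam * Sᵀ) (U₁ : Matrix (Fin D) (Fin n) ℝ)
    (U₂ W S₂ : Matrix (Fin n) (Fin n) ℝ) (hS₂ : S₂.PosDef) :
    optLoss b e k H s n d θ ≤ coreLoss b e k s Z U₁ U₂ V W S₂ ∧
      (coreLoss b e k s Z U₁ U₂ V W S₂ = optLoss b e k H s n d θ ↔
        U₁ = Z * Vᵀ * (V * Vᵀ + s • 1)⁻¹ ∧
        W = U₂ᵀ * (U₂ * U₂ᵀ + k • 1)⁻¹ ∧
        S₂ = (e / b) • (U₂ᵀ * U₂ + k • 1)⁻¹ ∧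
        U₂ * U₂ᵀ + k • 1 =
          P * diagonal (fun i : Fin n => max ((lam i ^ 2 + s) / H) k) * Pᵀ ∧
        ∀ i < n, lam i ^ 2 + s = optVar s (k * H) (s * θ i ^ 2 / e)) := by
  have hS := hsvd.right_orthogonal
  have hM : V * Vᵀ + s • 1 = P * diagonal (fun i : Fin n => lam i ^ 2 + s) * Pᵀ := by
    rw [gram_of_svd' hnd hS hV, diagonalization_add_smul_one _ _ hP]
  have hN : Vᵀ * V + s • 1 =
      S * diagonal (fun i : Fin d => (if (i : ℕ) < n then lam i ^ 2 else 0) + s) * Sᵀ := by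
    rw [gram_of_svd hP hV, diagonalization_add_smul_one _ _ hS]
  have hν : ∀ i : ℕ, 0 < (if (i : ℕ) < n then lam i ^ 2 else 0) + s := fun i => by
    split_ifs <;> positivity
  -- Alignment makes this trace a sum over singular values; the directions beyond the latent
  -- dimension `n` contribute $\theta_i^2$ in full.
  have htr : s * trace (Zᵀ * Z * (Vᵀ * V + s • 1)⁻¹) =
      ∑ i ∈ Finset.range n, e * (s * θ i ^ 2 / e / (lam i ^ 2 + s)) +
        ∑ i ∈ Finset.Ico n d, θ i ^ 2 := by
    rw [hsvd.gram, hN, inv_diagonalization hS (fun i => (hν i).ne'), trace_mul_diagonalization]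
    have e1 : ∀ q : Fin d → ℝ, Sᵀ * (S * diagonal q * Sᵀ) * S = diagonal q := fun q => by
      simp only [mul_assoc, orthogonal_transpose_mul hS, mul_one]
      rw [← mul_assoc, orthogonal_transpose_mul hS, one_mul]
    simp only [e1, diagonal_apply_eq]
    rw [← Finset.sum_range (fun i => θ i ^ 2 * ((if i < n then lam i ^ 2 else 0) + s)⁻¹),
      ← Finset.sum_range_add_sum_Ico _ hnd, mul_add, Finset.mul_sum, Finset.mul_sum]
    congr 1
    · refine Finset.sum_congr rfl fun i hi => ?_
      rw [if_pos (Finset.mem_range.1 hi)]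
      field_simp
    · refine Finset.sum_congr rfl fun i hi => ?_
      rw [if_neg (not_lt.2 (Finset.mem_Ico.1 hi).1), zero_add]
      field_simp
  have hMpd := posDef_gram_add V hs
  have b1 := decoder_bound hs Z U₁ V
  have b2 := encoder_bound hk hMpd U₂ W
  have b3 := variance_bound hb he (posDef_gram_add' U₂ hk) hS₂
  have b4 := second_decoder_bound he hk (H := H) hP hM U₂
  rw [det_gram_comm] at b3
  simp only [profile_scale hk] at b4
  rw [← Finset.sum_range (fun i => e * (profile ((lam i ^ 2 + s) / (k * H)) + Real.log k))] at b4
  have hbk : e / H = b * k := by rw [← hbkH]; field_simp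
  rw [hbk] at b4
  rw [htr] at b1
  have b5 : ∀ i ∈ Finset.range n, e * (s * θ i ^ 2 / e / optVar s (k * H) (s * θ i ^ 2 / e) +
      profile (optVar s (k * H) (s * θ i ^ 2 / e) / (k * H))) ≤
      e * (s * θ i ^ 2 / e / (lam i ^ 2 + s) + profile ((lam i ^ 2 + s) / (k * H))) := fun i _ =>
    mul_le_mul_of_nonneg_left (optVar_le hs (by positivity) (by positivity)
      (by nlinarith [sq_nonneg (lam i)])) he.le
  have b5s := Finset.sum_le_sum b5
  have b5e := Finset.sum_eq_sum_iff_of_le b5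
  have b5e' : (∀ i ∈ Finset.range n,
      e * (s * θ i ^ 2 / e / optVar s (k * H) (s * θ i ^ 2 / e) +
      profile (optVar s (k * H) (s * θ i ^ 2 / e) / (k * H))) =
      e * (s * θ i ^ 2 / e / (lam i ^ 2 + s) + profile ((lam i ^ 2 + s) / (k * H)))) ↔
      ∀ i < n, lam i ^ 2 + s = optVar s (k * H) (s * θ i ^ 2 / e) := by
    constructor
    · intro h i hi
      by_contra hne
      have := optVar_lt hs (by positivity : 0 < k * H) (by positivity : 0 ≤ s * θ i ^ 2 / e)
        (by nlinarith [sq_nonneg (lam i)]) hne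
      exact this.ne (mul_left_cancel₀ he.ne' (h i (Finset.mem_range.2 hi)))
    · intro h i hi
      rw [h i (Finset.mem_range.1 hi)]
  rw [b5e'] at b5e
  have hsplit : ∑ i ∈ Finset.range n,
      e * (s * θ i ^ 2 / e / (lam i ^ 2 + s) + profile ((lam i ^ 2 + s) / (k * H))) =
      ∑ i ∈ Finset.range n, e * (s * θ i ^ 2 / e / (lam i ^ 2 + s)) +
      ∑ i ∈ Finset.range n, e * (profile ((lam i ^ 2 + s) / (k * H)) + Real.log k) -
        n * (e * Real.log k) := by
    rw [← Finset.sum_add_distrib, ← nsmul_eq_mul, ← Finset.card_range n, ← Finset.sum_const,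
      Finset.card_range, ← Finset.sum_sub_distrib]
    exact Finset.sum_congr rfl fun i _ => by ring
  rw [hsplit] at b5s b5e
  have b2' := mul_le_mul_of_nonneg_left b2.1 hb.le
  unfold coreLoss optLoss
  constructor
  · linarith [b1.1, b3.1, b4.1]
  -- The gap is a sum of five nonnegative defects, so it vanishes exactly when each of them does.
  · rw [← b1.2, ← b2.2, ← b3.2, ← b4.2, ← b5e]
    constructor
    · intro h
      refine ⟨?_, mul_left_cancel₀ hb.ne' ?_, ?_, ?_, ?_⟩ <;> linarith [b1.1, b3.1, b4.1]
    · rintro ⟨h1, h2, h3, h4, h5⟩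
      rw [h1, h2, h3]
      linarith

/-! ### Alignment of the first encoder by rotations -/

/-- If no rotation of the latent space decreases the reconstruction error, the first encoder is
aligned with a singular value decomposition of `Z`. -/
theorem exists_aligned_of_rotation_optimal {D d n : ℕ} {s : ℝ} (hs : 0 < s)
    {Z : Matrix (Fin D) (Fin d) ℝ} {V : Matrix (Fin n) (Fin d) ℝ}
    (hrot : ∀ O ∈ Matrix.orthogonalGroup (Fin d) ℝ,
      trace (Zᵀ * Z * (Vᵀ * V + s • 1)⁻¹) ≤ trace (Zᵀ * Z * (Oᵀ * (Vᵀ * V + s • 1)⁻¹ * O))) :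
    ∃ R θ S P, ∃ x : ℕ → ℝ, IsSVD Z R θ S ∧ P ∈ Matrix.orthogonalGroup (Fin n) ℝ ∧
      Antitone x ∧ (∀ i, 0 ≤ x i) ∧ V = P * rectDiag n d (fun i => Real.sqrt (x i)) * Sᵀ := by
  -- One sorted eigenbasis $S$ for both Gram matrices supplies the right singular vectors of $Z$ and
  -- of $V$ at once.
  obtain ⟨S, hS, t, ν, ht, hν, hT, hN⟩ := exists_joint_sorted_diagonalization
    (by rw [transpose_mul, transpose_transpose]) (posDef_gram_add' V hs) hrot
  obtain ⟨R, θ, hsvd⟩ := exists_isSVD hS ht hT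
  have hVV : Vᵀ * V = S * diagonal (fun i => ν i + -s) * Sᵀ := by
    rw [← diagonalization_add_smul_one _ _ hS, ← hN]; module
  have h0 := diagonalization_gram_nonneg hS hVV
  have hx := extendZero_antitone (fun i j hij => by simpa using hν hij) h0
  obtain ⟨⟨P, hP, hV⟩, -⟩ := exists_left_factor hS hx (by
    simp only [extendZero_apply]; exact hVV)
  exact ⟨R, θ, S, P, _, hsvd, hP, hx, extendZero_nonneg h0, hV⟩

theorem gram_rotate_inv {d n : ℕ} {s : ℝ} (V : Matrix (Fin n) (Fin d) ℝ)
    {O : Matrix (Fin d) (Fin d) ℝ} (hO : O ∈ Matrix.orthogonalGroup (Fin d) ℝ) :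
    ((V * O)ᵀ * (V * O) + s • (1 : Matrix (Fin d) (Fin d) ℝ))⁻¹ =
      Oᵀ * (Vᵀ * V + s • 1)⁻¹ * O := by
  have hOO := orthogonal_transpose_mul hO
  have h : (V * O)ᵀ * (V * O) + s • (1 : Matrix (Fin d) (Fin d) ℝ) =
      Oᵀ * (Vᵀ * V + s • 1) * O := by
    rw [Matrix.mul_add, Matrix.add_mul, Matrix.mul_smul, Matrix.smul_mul, Matrix.mul_one, hOO,
      transpose_mul]
    simp only [Matrix.mul_assoc]
  rw [h, Matrix.mul_inv_rev, Matrix.mul_inv_rev, inv_eq_left_inv hOO,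
    inv_eq_left_inv (orthogonal_mul_transpose hO), mul_assoc]

theorem gram_rotate {d n : ℕ} (V : Matrix (Fin n) (Fin d) ℝ)
    {O : Matrix (Fin d) (Fin d) ℝ} (hO : O ∈ Matrix.orthogonalGroup (Fin d) ℝ) :
    (V * O) * (V * O)ᵀ = V * Vᵀ := by
  rw [transpose_mul, Matrix.mul_assoc, ← Matrix.mul_assoc O, orthogonal_mul_transpose hO,
    Matrix.one_mul]

/-- Rotating the first encoder and re-optimizing the first decoder changes only the reconstruction
error. -/
theorem coreLoss_rotate_le {D d n p : ℕ} {b e k s : ℝ} (hs : 0 < s) (Z : Matrix (Fin D) (Fin d) ℝ)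
    (U₁ : Matrix (Fin D) (Fin n) ℝ) (U₂ : Matrix (Fin n) (Fin p) ℝ) (V : Matrix (Fin n) (Fin d) ℝ)
    (W : Matrix (Fin p) (Fin n) ℝ) (S₂ : Matrix (Fin p) (Fin p) ℝ)
    {O : Matrix (Fin d) (Fin d) ℝ} (hO : O ∈ Matrix.orthogonalGroup (Fin d) ℝ) :
    ∃ U₁', coreLoss b e k s Z U₁' U₂ (V * O) W S₂ +
        s * trace (Zᵀ * Z * (Vᵀ * V + s • 1)⁻¹) ≤
      coreLoss b e k s Z U₁ U₂ V W S₂ + s * trace (Zᵀ * Z * (Oᵀ * (Vᵀ * V + s • 1)⁻¹ * O)) := by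
  -- The ridge-optimal decoder for the rotated encoder.
  refine ⟨Z * (V * O)ᵀ * ((V * O) * (V * O)ᵀ + s • 1)⁻¹, ?_⟩
  have h1 := (decoder_bound hs Z (Z * (V * O)ᵀ * ((V * O) * (V * O)ᵀ + s • 1)⁻¹) (V * O)).2.2 rfl
  have h2 := (decoder_bound hs Z U₁ V).1
  unfold coreLoss
  rw [h1, gram_rotate_inv V hO, gram_rotate V hO]
  linarith

/-- Rotating $V$ by a minimizer $O$ of the reconstruction term does not increase the loss once $U_1$
is re-optimized. The rotated encoder is aligned with some SVD of $Z$, possibly with other singular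
vectors but with the same `θ`, so the aligned bound applies. -/
theorem optLoss_le_coreLoss {D d n : ℕ} {b e k H s : ℝ} (hb : 0 < b) (he : 0 < e)
    (hk : 0 < k) (hH : 0 < H) (hs : 0 < s) (hbkH : b * k * H = e) (hnd : n ≤ d)
    {Z : Matrix (Fin D) (Fin d) ℝ} {R : Matrix (Fin D) (Fin D) ℝ} {θ : ℕ → ℝ}
    {S : Matrix (Fin d) (Fin d) ℝ} (hsvd : IsSVD Z R θ S) (U₁ : Matrix (Fin D) (Fin n) ℝ)
    (U₂ : Matrix (Fin n) (Fin n) ℝ) (V : Matrix (Fin n) (Fin d) ℝ)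
    (W S₂ : Matrix (Fin n) (Fin n) ℝ) (hS₂ : S₂.PosDef) :
    optLoss b e k H s n d θ ≤ coreLoss b e k s Z U₁ U₂ V W S₂ := by
  obtain ⟨O, hO, hmin⟩ := exists_rotation_minimizer (Zᵀ * Z) (Vᵀ * V + s • 1)⁻¹
  obtain ⟨R', θ', S', P, x, hsvd', hP, -, -, hV⟩ :=
    exists_aligned_of_rotation_optimal (Z := Z) (V := V * O) hs (by
      intro O' hO'
      rw [gram_rotate_inv V hO]
      have := hmin (O * O') (mul_mem hO hO')
      rw [transpose_mul] at this
      simpa only [mul_assoc] using this)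
  obtain ⟨U₁', hU⟩ := coreLoss_rotate_le (b := b) (e := e) (k := k) hs Z U₁ U₂ V W S₂ hO
  have h1 := hmin 1 (one_mem _)
  rw [transpose_one, one_mul, mul_one] at h1
  have h2 := mul_le_mul_of_nonneg_left h1 hs.le
  have h3 := (optLoss_le_coreLoss_of_aligned hb he hk hH hs hbkH hnd hsvd' hP hV U₁' U₂ W S₂
    hS₂).1
  rw [hsvd.singularValues_unique hsvd']
  linarith

/-- A point attaining the optimal value is aligned with a singular value decomposition of `Z`. -/
theorem exists_aligned_of_coreLoss_eq {D d n : ℕ} {b e k H s : ℝ} (hb : 0 < b) (he : 0 < e)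
    (hk : 0 < k) (hH : 0 < H) (hs : 0 < s) (hbkH : b * k * H = e) (hnd : n ≤ d)
    {Z : Matrix (Fin D) (Fin d) ℝ} {R : Matrix (Fin D) (Fin D) ℝ} {θ : ℕ → ℝ}
    {S : Matrix (Fin d) (Fin d) ℝ} (hsvd : IsSVD Z R θ S) {U₁ : Matrix (Fin D) (Fin n) ℝ}
    {U₂ : Matrix (Fin n) (Fin n) ℝ} {V : Matrix (Fin n) (Fin d) ℝ}
    {W S₂ : Matrix (Fin n) (Fin n) ℝ} (hS₂ : S₂.PosDef)
    (heq : coreLoss b e k s Z U₁ U₂ V W S₂ = optLoss b e k H s n d θ) :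
    ∃ R θ S P, ∃ x : ℕ → ℝ, IsSVD Z R θ S ∧ P ∈ Matrix.orthogonalGroup (Fin n) ℝ ∧
      Antitone x ∧ (∀ i, 0 ≤ x i) ∧ V = P * rectDiag n d (fun i => Real.sqrt (x i)) * Sᵀ := by
  -- A rotation that lowered the reconstruction term would push the loss below its lower bound.
  refine exists_aligned_of_rotation_optimal hs fun O hO => ?_
  obtain ⟨U₁', hU⟩ := coreLoss_rotate_le (b := b) (e := e) (k := k) hs Z U₁ U₂ V W S₂ hO
  have h := optLoss_le_coreLoss hb he hk hH hs hbkH hnd hsvd U₁' U₂ (V * O) W S₂ hS₂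
  refine le_of_mul_le_mul_left ?_ hs
  linarith

/-! ### The form of the minimizers -/

/-- The form of the global minimizers, with the singular values written through `optVar`. -/
structure IsOptimalForm {D d n : ℕ} (b e k H s : ℝ) (Z : Matrix (Fin D) (Fin d) ℝ)
    (U₁ : Matrix (Fin D) (Fin n) ℝ) (U₂ : Matrix (Fin n) (Fin n) ℝ) (V : Matrix (Fin n) (Fin d) ℝ)
    (W S₂ : Matrix (Fin n) (Fin n) ℝ) (R : Matrix (Fin D) (Fin D) ℝ)
    (S : Matrix (Fin d) (Fin d) ℝ) (θ : ℕ → ℝ) (P Q : Matrix (Fin n) (Fin n) ℝ)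
    (lam ω : ℕ → ℝ) : Prop where
  svd : IsSVD Z R θ S
  left_orthogonal : P ∈ Matrix.orthogonalGroup (Fin n) ℝ
  right_orthogonal : Q ∈ Matrix.orthogonalGroup (Fin n) ℝ
  encoder_eq : V = P * rectDiag n d lam * Sᵀ
  second_decoder_eq : U₂ = P * rectDiag n n ω * Qᵀ
  second_encoder_eq : W = U₂ᵀ * (U₂ * U₂ᵀ + k • 1)⁻¹
  decoder_eq : U₁ = Z * Vᵀ * (V * Vᵀ + s • 1)⁻¹
  variance_eq : S₂ = (e / b) • (U₂ᵀ * U₂ + k • 1)⁻¹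
  singularValues_eq : ∀ i < n, lam i = Real.sqrt (optVar s (k * H) (s * θ i ^ 2 / e) - s) ∧
    ω i = Real.sqrt (max (optVar s (k * H) (s * θ i ^ 2 / e) / H) k - k)

theorem IsOptimalForm.coreLoss_eq {D d n : ℕ} {b e k H s : ℝ} (hb : 0 < b) (he : 0 < e)
    (hk : 0 < k) (hH : 0 < H) (hs : 0 < s) (hbkH : b * k * H = e) (hnd : n ≤ d)
    {Z : Matrix (Fin D) (Fin d) ℝ} {U₁ : Matrix (Fin D) (Fin n) ℝ} {U₂ : Matrix (Fin n) (Fin n) ℝ}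
    {V : Matrix (Fin n) (Fin d) ℝ} {W S₂ : Matrix (Fin n) (Fin n) ℝ}
    {R : Matrix (Fin D) (Fin D) ℝ} {S : Matrix (Fin d) (Fin d) ℝ} {θ : ℕ → ℝ}
    {P Q : Matrix (Fin n) (Fin n) ℝ} {lam ω : ℕ → ℝ}
    (h : IsOptimalForm b e k H s Z U₁ U₂ V W S₂ R S θ P Q lam ω) :
    S₂.PosDef ∧ coreLoss b e k s Z U₁ U₂ V W S₂ = optLoss b e k H s n d θ := by
  have hS₂ : S₂.PosDef := by
    rw [h.variance_eq]
    exact (posDef_gram_add' U₂ hk).inv.smul (by positivity)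
  have hlam : ∀ i < n, lam i ^ 2 + s = optVar s (k * H) (s * θ i ^ 2 / e) := fun i hi => by
    rw [(h.singularValues_eq i hi).1, Real.sq_sqrt (sub_nonneg.2 (le_optVar _ _ _)),
      sub_add_cancel]
  refine ⟨hS₂, (optLoss_le_coreLoss_of_aligned hb he hk hH hs hbkH hnd h.svd h.left_orthogonal
    h.encoder_eq U₁ U₂ W S₂ hS₂).2.2
    ⟨h.decoder_eq, h.second_encoder_eq, h.variance_eq, ?_, hlam⟩⟩
  rw [gram_of_svd' le_rfl h.right_orthogonal h.second_decoder_eq,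
    diagonalization_add_smul_one _ _ h.left_orthogonal]
  congr 3
  funext i
  rw [hlam i i.2, (h.singularValues_eq i i.2).2, Real.sq_sqrt (sub_nonneg.2 (le_max_right _ _)),
    sub_add_cancel]

theorem exists_isOptimalForm {D d n : ℕ} (b e k H s : ℝ) (Z : Matrix (Fin D) (Fin d) ℝ) :
    ∃ (U₁ : Matrix (Fin D) (Fin n) ℝ) (U₂ : Matrix (Fin n) (Fin n) ℝ)
      (V : Matrix (Fin n) (Fin d) ℝ) (W S₂ : Matrix (Fin n) (Fin n) ℝ), ∃ R S θ P Q lam ω,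
      IsOptimalForm b e k H s Z U₁ U₂ V W S₂ R S θ P Q lam ω := by
  have hZ : (Zᵀ * Z).IsHermitian := by
    simp [Matrix.IsHermitian, transpose_mul]
  obtain ⟨S, hS, t, ht, hZS⟩ := exists_sorted_diagonalization hZ
  obtain ⟨R, θ, hsvd⟩ := exists_isSVD hS ht hZS
  exact ⟨_, _, _, _, _, R, S, θ, 1, 1, _, _, hsvd, one_mem _, one_mem _, rfl, rfl, rfl, rfl, rfl,
    fun i _ => ⟨rfl, rfl⟩⟩

/-- Alignment gives $V$; the equality conditions then determine its singular values and
$U_2U_2^\top$, and only the right factor $Q$ of $U_2$ remains to be found. -/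
theorem exists_isOptimalForm_of_coreLoss_eq {D d n : ℕ} {b e k H s : ℝ} (hb : 0 < b) (he : 0 < e)
    (hk : 0 < k) (hH : 0 < H) (hs : 0 < s) (hbkH : b * k * H = e) (hnd : n ≤ d)
    {Z : Matrix (Fin D) (Fin d) ℝ} {R : Matrix (Fin D) (Fin D) ℝ} {θ : ℕ → ℝ}
    {S : Matrix (Fin d) (Fin d) ℝ} (hsvd : IsSVD Z R θ S) {U₁ : Matrix (Fin D) (Fin n) ℝ}
    {U₂ : Matrix (Fin n) (Fin n) ℝ} {V : Matrix (Fin n) (Fin d) ℝ}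
    {W S₂ : Matrix (Fin n) (Fin n) ℝ} (hS₂ : S₂.PosDef)
    (heq : coreLoss b e k s Z U₁ U₂ V W S₂ = optLoss b e k H s n d θ) :
    ∃ R S θ P Q lam ω, IsOptimalForm b e k H s Z U₁ U₂ V W S₂ R S θ P Q lam ω := by
  obtain ⟨R', θ', S', P, x, hsvd', hP, hx, hx0, hV⟩ :=
    exists_aligned_of_coreLoss_eq hb he hk hH hs hbkH hnd hsvd hS₂ heq
  rw [hsvd.singularValues_unique hsvd'] at heq
  obtain ⟨h1, h2, h3, h4, h5⟩ := (optLoss_le_coreLoss_of_aligned hb he hk hH hs hbkH hnd hsvd' hP hV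
    U₁ U₂ W S₂ hS₂).2.1 heq
  simp only [Real.sq_sqrt (hx0 _)] at h4 h5
  set y : ℕ → ℝ := fun i => max ((x i + s) / H) k - k with hy
  have hyanti : Antitone y := fun i j hij => by
    have := hx hij
    simp only [hy]
    gcongr
  -- Factoring $U_2^\top$ rather than $U_2$ keeps the $P$ of the encoder as the left factor of
  -- $U_2$. The order needed for this is inherited from the singular values of $V$.
  have hU : U₂ᵀᵀ * U₂ᵀ = P * diagonal (fun i : Fin n => y i) * Pᵀ := by
    have := diagonalization_add_smul_one (fun i : Fin n => max ((x i + s) / H) k) (-k) hP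
    rw [← h4] at this
    rw [transpose_transpose]
    simp only [hy, sub_eq_add_neg]
    rw [← this]
    module
  obtain ⟨⟨Q, hQ, hUQ⟩, -⟩ := exists_left_factor hP hyanti hU
  refine ⟨R', S', θ', P, Q, _, fun i => Real.sqrt (y i), hsvd', hP, hQ, hV, ?_, h2, h1, h3,
    fun i hi => ⟨?_, ?_⟩⟩
  · rw [← transpose_transpose U₂, hUQ, transpose_mul, transpose_mul, transpose_transpose,
      transpose_rectDiag, Matrix.mul_assoc]
  · rw [← h5 i hi, add_sub_cancel_right]
  · rw [← h5 i hi]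

end HVAE

theorem theorem4 {D₀ d₀ d₁ d₂ : ℕ} (hd₁ : d₁ ≤ d₀) (hd₂ : d₁ = d₂)
    (β₁ β₂ ηenc ηdec σ₁ : ℝ) (hβ₁ : 0 < β₁) (hβ₂ : 0 < β₂)
    (hηenc : 0 < ηenc) (hηdec : 0 < ηdec) (hσ₁ : 0 < σ₁)
    (μ : MeasureTheory.Measure (Fin D₀ → ℝ)) [MeasureTheory.IsProbabilityMeasure μ]
    (hμ : ∀ i, MeasureTheory.MemLp (fun x : Fin D₀ → ℝ => x i) 2 μ)
    (PA : Matrix (Fin D₀) (Fin d₀) ℝ) (φ : Fin d₀ → ℝ)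
    (hA : HVAE.IsPosEigenDecomp (HVAE.secondMoment μ) PA φ)
    (Z : Matrix (Fin D₀) (Fin d₀) ℝ) (hZ : Z = HVAE.crossMoment μ PA φ)
    (S1 : Matrix (Fin d₁) (Fin d₁) ℝ) (hS1 : S1 = σ₁ ^ 2 • (1 : Matrix (Fin d₁) (Fin d₁) ℝ)) :
    (∃ (U1 : Matrix (Fin D₀) (Fin d₁) ℝ) (U2 : Matrix (Fin d₁) (Fin d₂) ℝ)
        (V1 : Matrix (Fin d₁) (Fin d₀) ℝ) (W2 : Matrix (Fin d₂) (Fin d₁) ℝ)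
        (S2 : Matrix (Fin d₂) (Fin d₂) ℝ),
        HVAE.IsGlobalMinimizer β₁ β₂ ηenc ηdec Z S1 U1 U2 V1 W2 S2) ∧
    ∀ (U1 : Matrix (Fin D₀) (Fin d₁) ℝ) (U2 : Matrix (Fin d₁) (Fin d₂) ℝ)
      (V1 : Matrix (Fin d₁) (Fin d₀) ℝ) (W2 : Matrix (Fin d₂) (Fin d₁) ℝ)
      (S2 : Matrix (Fin d₂) (Fin d₂) ℝ),
      HVAE.IsGlobalMinimizer β₁ β₂ ηenc ηdec Z S1 U1 U2 V1 W2 S2 ↔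
      ∃ (R : Matrix (Fin D₀) (Fin D₀) ℝ) (S : Matrix (Fin d₀) (Fin d₀) ℝ) (θ : ℕ → ℝ)
        (P : Matrix (Fin d₁) (Fin d₁) ℝ) (Q : Matrix (Fin d₂) (Fin d₂) ℝ) (lam ω : ℕ → ℝ),
        HVAE.IsSVD Z R θ S ∧
        P ∈ Matrix.orthogonalGroup (Fin d₁) ℝ ∧
        Q ∈ Matrix.orthogonalGroup (Fin d₂) ℝ ∧
        V1 = P * HVAE.rectDiag d₁ d₀ lam * S.transpose ∧
        U2 = P * HVAE.rectDiag d₁ d₂ ω * Q.transpose ∧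
        W2 = U2.transpose *
          (U2 * U2.transpose + ((ηdec / ηenc) ^ 2 * (β₂ / β₁)) • 1)⁻¹ ∧
        U1 = Z * V1.transpose * (V1 * V1.transpose + S1)⁻¹ ∧
        S2 = (β₂ / β₁ * ηdec ^ 2) •
          (U2.transpose * U2 + ((ηdec / ηenc) ^ 2 * (β₂ / β₁)) • 1)⁻¹ ∧
        ∀ i : ℕ, i < d₁ →
          -- (a)
          (β₂ * ηdec ^ 2 / σ₁ ^ 2 * max (σ₁ ^ 2) (β₂ / β₁ * ηdec ^ 2) ≤ θ i ^ 2 →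
            lam i = σ₁ / (Real.sqrt β₂ * ηdec) * Real.sqrt (θ i ^ 2 - β₂ * ηdec ^ 2) ∧
            ω i = Real.sqrt (σ₁ ^ 2 * θ i ^ 2 / (β₂ * ηenc ^ 2 * ηdec ^ 2)
              - β₂ / β₁ * (ηdec ^ 2 / ηenc ^ 2))) ∧
          -- (b)
          (θ i ^ 2 < β₂ * ηdec ^ 2 / σ₁ ^ 2 * max (σ₁ ^ 2) (β₂ / β₁ * ηdec ^ 2) →
            β₂ / β₁ * ηdec ^ 2 ≤ σ₁ ^ 2 →
            lam i = 0 ∧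
            ω i = Real.sqrt ((σ₁ ^ 2 - β₂ / β₁ * ηdec ^ 2) / ηenc ^ 2)) ∧
          -- (c)
          (θ i ^ 2 < β₂ * ηdec ^ 2 / σ₁ ^ 2 * max (σ₁ ^ 2) (β₂ / β₁ * ηdec ^ 2) →
            σ₁ ^ 2 < β₂ / β₁ * ηdec ^ 2 →
            lam i = Real.sqrt (max 0 (σ₁ / Real.sqrt β₁ * (θ i - Real.sqrt β₁ * σ₁))) ∧
            ω i = 0) := by
  subst hd₂ hS1
  have hb := hβ₁
  have he : 0 < β₂ * ηdec ^ 2 := by positivity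
  have hk : 0 < (ηdec / ηenc) ^ 2 * (β₂ / β₁) := by positivity
  have hH : 0 < ηenc ^ 2 := by positivity
  have hs : 0 < σ₁ ^ 2 := by positivity
  have hbkH : β₁ * ((ηdec / ηenc) ^ 2 * (β₂ / β₁)) * ηenc ^ 2 = β₂ * ηdec ^ 2 := by field_simp
  have hkH : (ηdec / ηenc) ^ 2 * (β₂ / β₁) * ηenc ^ 2 = β₂ / β₁ * ηdec ^ 2 := by field_simp
  have heb : β₂ * ηdec ^ 2 / β₁ = β₂ / β₁ * ηdec ^ 2 := by ring
  -- A reference point of optimal form: it attains the lower bound, so being a global minimizer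
  -- means having loss value `optLoss` for `θ₀`.
  obtain ⟨V₁, V₂, V₃, V₄, V₅, R₀, S₀, θ₀, P₀, Q₀, lam₀, ω₀, h₀⟩ :=
    HVAE.exists_isOptimalForm (n := d₁) β₁ (β₂ * ηdec ^ 2) ((ηdec / ηenc) ^ 2 * (β₂ / β₁))
      (ηenc ^ 2) (σ₁ ^ 2) Z
  have hmin : ∀ (U1 : Matrix (Fin D₀) (Fin d₁) ℝ) (U2 : Matrix (Fin d₁) (Fin d₁) ℝ)
      (V1 : Matrix (Fin d₁) (Fin d₀) ℝ) (W2 S2 : Matrix (Fin d₁) (Fin d₁) ℝ),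
      HVAE.IsGlobalMinimizer β₁ β₂ ηenc ηdec Z (σ₁ ^ 2 • 1) U1 U2 V1 W2 S2 ↔
        S2.PosDef ∧ HVAE.coreLoss β₁ (β₂ * ηdec ^ 2) ((ηdec / ηenc) ^ 2 * (β₂ / β₁)) (σ₁ ^ 2) Z
          U1 U2 V1 W2 S2 = HVAE.optLoss β₁ (β₂ * ηdec ^ 2) ((ηdec / ηenc) ^ 2 * (β₂ / β₁))
            (ηenc ^ 2) (σ₁ ^ 2) d₁ d₀ θ₀ := by
    intro U1 U2 V1 W2 S2
    have hpos : 0 < 1 / ηdec ^ 2 := by positivity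
    unfold HVAE.IsGlobalMinimizer
    simp only [HVAE.loss_eq_coreLoss hβ₁.ne' hηdec.ne', sub_le_sub_iff_right,
      mul_le_mul_iff_right₀ hpos]
    refine and_congr_right fun hS2 => ⟨fun h => le_antisymm ?_ ?_, fun h U1' U2' V1' W2' S2' hS2' => ?_⟩
    · have h1 := h₀.coreLoss_eq hb he hk hH hs hbkH hd₁
      rw [← h1.2]
      exact h _ _ _ _ _ h1.1
    · exact HVAE.optLoss_le_coreLoss hb he hk hH hs hbkH hd₁ h₀.svd _ _ _ _ _ hS2
    · rw [h]
      exact HVAE.optLoss_le_coreLoss hb he hk hH hs hbkH hd₁ h₀.svd _ _ _ _ _ hS2'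
  refine ⟨⟨V₁, V₂, V₃, V₄, V₅, (hmin _ _ _ _ _).2 (h₀.coreLoss_eq hb he hk hH hs hbkH hd₁)⟩,
    fun U1 U2 V1 W2 S2 => ⟨fun h => ?_, ?_⟩⟩
  · obtain ⟨hS2, heq⟩ := (hmin _ _ _ _ _).1 h
    obtain ⟨R, S, θ, P, Q, lam, ω, hf⟩ := HVAE.exists_isOptimalForm_of_coreLoss_eq hb he hk hH hs
      hbkH hd₁ h₀.svd hS2 heq
    refine ⟨R, S, θ, P, Q, lam, ω, hf.svd, hf.left_orthogonal, hf.right_orthogonal, hf.encoder_eq,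
      hf.second_decoder_eq, hf.second_encoder_eq, hf.decoder_eq, heb ▸ hf.variance_eq,
      fun i hi => ?_⟩
    rw [HVAE.optimal_singular_values_iff hβ₁ hβ₂ hηenc hηdec hσ₁ (hf.svd.nonneg i), ← hkH]
    exact hf.singularValues_eq i hi
  · rintro ⟨R, S, θ, P, Q, lam, ω, hsvd, hP, hQ, hV, hU, hW, hU1, hS2, hsing⟩
    have hf : HVAE.IsOptimalForm β₁ (β₂ * ηdec ^ 2) ((ηdec / ηenc) ^ 2 * (β₂ / β₁))
        (ηenc ^ 2) (σ₁ ^ 2) Z U1 U2 V1 W2 S2 R S θ P Q lam ω := by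
      refine ⟨hsvd, hP, hQ, hV, hU, hW, hU1, heb.symm ▸ hS2, fun i hi => ?_⟩
      have := (HVAE.optimal_singular_values_iff hβ₁ hβ₂ hηenc hηdec hσ₁ (hsvd.nonneg i)).1
        (hsing i hi)
      rwa [← hkH] at this
    -- The given SVD may differ from the reference one, but its singular values, hence the optimal
    -- value, are the same.
    rw [hmin, h₀.svd.singularValues_unique hsvd]
    exact hf.coreLoss_eq hb he hk hH hs hbkH hd₁
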